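/- Let $p$ be a prime, $K$ a field of characteristic $p$, and $c\in K$. **Steenrod algebra with $P^0=c$.** Let $\mathfrak A(p)$ be the associative unital $K$-algebra generated by $P^i$ ($i\ge 0$; written $Sq^i$ when $p=2$) and, if $p>2$, also by $\beta$, with the relations $P^0=c\cdot 1$, the Adem relations $$P^aP^b=\sum_{i=0}^{[a/p]}(-1)^{a+i}\binom{(p-1)(b-i)-1}{a-pi}P^{a+b-i}P^i\qquad(a<pb),$$ and, if $p>2$, also $\beta^2=0$ and $$P^a\beta P^b=\sum_{i=0}^{[a/p]}(-1)^{a+i}\binom{(p-1)(b-i)}{a-pi}\beta P^{a+b-i}P^i-\sum_{i=0}^{[(a-1)/p]}(-1)^{a+i}\binom{(p-1)(b-i)-1}{a-pi-1}P^{a+b-i}\beta P^i\qquad(a\le pb).$$ It is $\mathbb Z$-graded by $\deg\beta=1$ and $\deg P^i=2i(p-1)$ for $p>2$, and by $\deg Sq^i=i$ for $p=2$. **Lie superalgebras.** A Lie superalgebra $\mathfrak g=\mathfrak g_{\bar 0}\oplus\mathfrak g_{\bar 1}$ over $K$ has a bilinear bracket compatible with parity, satisfying super anti-commutativity, $[x,x]=0$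 for even $x$, and the super Jacobi identity, together with a squaring $\mathfrak g_{\bar 1}\to\mathfrak g_{\bar 0}$, $x\mapsto x^2$, such that $(ax)^2=a^2x^2$ for $a\in K$, $(x+y)^2=x^2+y^2+[x,y]$, $[x^2,z]=[x,[x,z]]$ and $[x,x^2]=0$ for all $x,y\in\mathfrak g_{\bar 1}$, $z\in\mathfrak g$. (For $p>2$ necessarily $x^2=\frac12[x,x]$; for $p=2$ the squaring is part of the structure.) It is restricted if it is equipped with a map $x\mapsto x^{[p]}$ on $\mathfrak g_{\bar 0}$ making $\mathfrak g_{\bar 0}$ a restricted Lie algebra and satisfying $[x^{[p]},y]=(\mathrm{ad}\,x)^p(y)$ for all $x\in\mathfrak g_{\bar 0}$, $y\in\mathfrak g$. The universal enveloping algebra $U(\mathfrak g)$ is the quotient of the tensor algebra $T(\mathfrak g)$ by the relations $x\otimes y-(-1)^{|x||y|}y\otimes x=[x,y]$ for homogeneous $x,y$, and $x\otimes x=x^2$ for odd $x$. The restricted universal enveloping algebra is the quotient of $U(\mathfrak g)$ by the further relations $x^p=x^{[p]}$ for even $x$. **Theorem.** Let $\mathfrak g=\bigoplus_{k\in\mathbb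 Z}\mathfrak g_k$ be any $\mathbb Z$-graded Lie superalgebra over $K$ (so $[\mathfrak g_k,\mathfrak g_l]\subseteq\mathfrak g_{k+l}$, and $x^2\in\mathfrak g_{2k}$ for odd $x\in\mathfrak g_k$) in which the elements of $\mathfrak g_k$ have parity $k \bmod 2$. Then there is no grading-preserving isomorphism of $K$-algebras between $\mathfrak A(p)$ and $U(\mathfrak g)$ with its induced grading. Moreover, for any restricted structure on $\mathfrak g$ compatible with the grading (that is, $x^{[p]}\in\mathfrak g_{pk}$ for even $x\in\mathfrak g_k$), there is no grading-preserving isomorphism of $K$-algebras between $\mathfrak A(p)$ and the restricted universal enveloping algebra of $\mathfrak g$ with its induced grading. -/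

import Mathlib

open Polynomial in
/-- The element `s_i(x, y)` of Jacobson's formula
`(x + y)^[p] = x^[p] + y^[p] + ∑_{0 < i < p} s_i(x, y)`: by definition `i * s_i(x, y)` is the
coefficient of `t^(i-1)` in `(ad (t x + y))^(p-1) (x)`. Here `ad` is the adjoint representation. -/
noncomputable def jacobsonTerm {K : Type*} [Field K] {g : Type*} [AddCommGroup g] [Module K g]
    (ad : g →ₗ[K] g →ₗ[K] g) (p i : ℕ) (x y : g) : g :=
  ((i : K)⁻¹) •
    ((((C (ad x : Module.End K g) * X + C (ad y : Module.End K g)) ^ (p - 1)).coeff (i - 1) :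
      Module.End K g) x)

/-- The sign `(-1)^(i j)` of the sign rule, for parities `i` and `j`. -/
def superSign (i j : ZMod 2) : ℤ := if i = 1 ∧ j = 1 then -1 else 1

/-- A Lie superalgebra structure on the `K`-vector space `g`, over a field `K` of arbitrary
characteristic: a `ℤ/2`-grading `g = g_0 ⊕ g_1`, a bilinear bracket and a squaring
`g_1 → g_0` whose polarization is the bracket of odd elements.

If the characteristic is not 2, then `sq_smul` and `sq_add` force `sq x = [x, x] / 2`, and
`sq_bracket` is a consequence of the Jacobi identity; in characteristic 2 the squaring is part of
the data. The axiom `bracket_sq_self` is redundant unless the characteristic is 3. -/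
structure LieSuperalgebra (K : Type*) [Field K] (g : Type*) [AddCommGroup g] [Module K g] where
  /-- the even part `g_0` and the odd part `g_1` -/
  part : ZMod 2 → Submodule K g
  isInternal : DirectSum.IsInternal part
  /-- the bracket -/
  bracket : g →ₗ[K] g →ₗ[K] g
  bracket_mem : ∀ {i j : ZMod 2} {x y : g}, x ∈ part i → y ∈ part j → bracket x y ∈ part (i + j)
  /-- super anti-commutativity -/
  bracket_skew : ∀ {i j : ZMod 2} {x y : g}, x ∈ part i → y ∈ part j →
    bracket x y = -(superSign i j • bracket y x)
  bracket_self : ∀ {x : g}, x ∈ part 0 → bracket x x = 0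
  /-- super Jacobi identity -/
  jacobi : ∀ {i j : ZMod 2} {x y : g} (z : g), x ∈ part i → y ∈ part j →
    bracket x (bracket y z) = bracket (bracket x y) z + superSign i j • bracket y (bracket x z)
  /-- the squaring `x ↦ x²` of odd elements -/
  sq : part 1 → part 0
  sq_smul : ∀ (a : K) (x : part 1), sq (a • x) = a ^ 2 • sq x
  sq_add : ∀ x y : part 1, (sq (x + y) : g) = sq x + sq y + bracket x y
  sq_bracket : ∀ (y : part 1) (x : g), bracket (sq y) x = bracket y (bracket y x)
  bracket_sq_self : ∀ x : part 1, bracket x (sq x) = 0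

/-- `𝒢` is a `ℤ`-grading `g = ⨁ g_k` of the Lie superalgebra `g` for which the elements of `g_k`
have the parity of `k`. -/
structure LieSuperalgebra.IsZGrading {K : Type*} [Field K] {g : Type*} [AddCommGroup g]
    [Module K g] (L : LieSuperalgebra K g) (𝒢 : ℤ → Submodule K g) : Prop where
  isInternal : DirectSum.IsInternal 𝒢
  bracket_mem : ∀ {k l : ℤ} {x y : g}, x ∈ 𝒢 k → y ∈ 𝒢 l → L.bracket x y ∈ 𝒢 (k + l)
  sq_mem : ∀ {k : ℤ} (x : L.part 1), (x : g) ∈ 𝒢 k → (L.sq x : g) ∈ 𝒢 (2 * k)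
  parity : ∀ k : ℤ, 𝒢 k ≤ L.part (k : ZMod 2)

/-- A restricted structure on a Lie superalgebra in characteristic `p`: a `p`-th power operation
`x ↦ x^[p]` that makes the even part a restricted Lie algebra and the whole of `g` a restricted
module over it. -/
structure LieSuperalgebra.RestrictedStructure {K : Type*} [Field K] {g : Type*} [AddCommGroup g]
    [Module K g] (L : LieSuperalgebra K g) (p : ℕ) where
  /-- the operation `x ↦ x^[p]` -/
  pmap : L.part 0 → L.part 0
  pmap_smul : ∀ (a : K) (x : L.part 0), pmap (a • x) = a ^ p • pmap x
  pmap_add : ∀ x y : L.part 0, (pmap (x + y) : g) =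
    pmap x + pmap y + ∑ i ∈ Finset.Ioo 0 p, jacobsonTerm L.bracket p i (x : g) (y : g)
  bracket_pmap : ∀ (x : L.part 0) (y : g), L.bracket (pmap x) y = (L.bracket x)^[p] y

/-- The `p`-th power operation is homogeneous: it maps `g_k` to `g_{pk}`. -/
def LieSuperalgebra.RestrictedStructure.IsHomogeneous {K : Type*} [Field K] {g : Type*}
    [AddCommGroup g] [Module K g] {L : LieSuperalgebra K g} {p : ℕ}
    (R : L.RestrictedStructure p) (𝒢 : ℤ → Submodule K g) : Prop :=
  ∀ (k : ℤ) (x : L.part 0), (x : g) ∈ 𝒢 k → (R.pmap x : g) ∈ 𝒢 (p * k)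

/-- The component of degree `k` of an algebra generated by homogeneous elements: the span of all
products `a₁ ⋯ aₙ` (with `n ≥ 0`) where `aᵢ` lies in the given set `S kᵢ` of generators of degree
`kᵢ` and `k₁ + ⋯ + kₙ = k`. -/
def generatedGrading (K : Type*) [Field K] {A : Type*} [Ring A] [Algebra K A] (S : ℤ → Set A)
    (k : ℤ) : Submodule K A :=
  Submodule.span K {a | ∃ l : List (ℤ × A), (∀ q ∈ l, q.2 ∈ S q.1) ∧
    (l.map Prod.fst).sum = k ∧ (l.map Prod.snd).prod = a}

namespace LieSuperalgebra

section Enveloping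

variable {K : Type*} [Field K] {g : Type*} [AddCommGroup g] [Module K g]

/-- The defining relations of the universal enveloping algebra, as relations in `T(g)`. -/
inductive EnvelopingRel (L : LieSuperalgebra K g) : TensorAlgebra K g → TensorAlgebra K g → Prop
  | bracket {i j : ZMod 2} {x y : g} (hx : x ∈ L.part i) (hy : y ∈ L.part j) :
      EnvelopingRel L
        (TensorAlgebra.ι K x * TensorAlgebra.ι K y -
          superSign i j • (TensorAlgebra.ι K y * TensorAlgebra.ι K x))
        (TensorAlgebra.ι K (L.bracket x y))
  | sq (x : L.part 1) :
      EnvelopingRel L (TensorAlgebra.ι K (x : g) * TensorAlgebra.ι K (x : g))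
        (TensorAlgebra.ι K (L.sq x : g))

/-- The (ordinary) universal enveloping algebra `U(g)`. -/
def Enveloping (L : LieSuperalgebra K g) : Type _ := RingQuot L.EnvelopingRel

noncomputable instance Enveloping.instRing (L : LieSuperalgebra K g) : Ring L.Enveloping :=
  RingQuot.instRing L.EnvelopingRel

noncomputable instance Enveloping.instAlgebra (L : LieSuperalgebra K g) :
    Algebra K L.Enveloping :=
  RingQuot.instAlgebra L.EnvelopingRel

/-- The projection `T(g) → U(g)`. -/
noncomputable def Enveloping.mk (L : LieSuperalgebra K g) :
    TensorAlgebra K g →ₐ[K] L.Enveloping :=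
  RingQuot.mkAlgHom K L.EnvelopingRel

/-- The canonical map `g → U(g)`. -/
noncomputable def Enveloping.ι (L : LieSuperalgebra K g) : g →ₗ[K] L.Enveloping :=
  (Enveloping.mk L).toLinearMap ∘ₗ TensorAlgebra.ι K

/-- The grading of `U(g)` induced by a grading of `g`. -/
noncomputable def Enveloping.grading (L : LieSuperalgebra K g) (𝒢 : ℤ → Submodule K g) :
    ℤ → Submodule K L.Enveloping :=
  generatedGrading K (fun k => Enveloping.ι L '' (𝒢 k : Set g))

/-- The defining relations of the restricted universal enveloping algebra: those of `U(g)`, and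
`x^p = x^[p]` for even `x`. -/
inductive RestrictedEnvelopingRel {L : LieSuperalgebra K g} {p : ℕ} (R : L.RestrictedStructure p) :
    TensorAlgebra K g → TensorAlgebra K g → Prop
  | enveloping {a b : TensorAlgebra K g} (h : L.EnvelopingRel a b) : RestrictedEnvelopingRel R a b
  | pmap (x : L.part 0) :
      RestrictedEnvelopingRel R (TensorAlgebra.ι K (x : g) ^ p)
        (TensorAlgebra.ι K (R.pmap x : g))

/-- The restricted universal enveloping algebra. -/
def RestrictedEnveloping {L : LieSuperalgebra K g} {p : ℕ} (R : L.RestrictedStructure p) :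
    Type _ :=
  RingQuot (RestrictedEnvelopingRel R)

noncomputable instance RestrictedEnveloping.instRing {L : LieSuperalgebra K g} {p : ℕ}
    (R : L.RestrictedStructure p) : Ring (RestrictedEnveloping R) :=
  RingQuot.instRing (RestrictedEnvelopingRel R)

noncomputable instance RestrictedEnveloping.instAlgebra {L : LieSuperalgebra K g} {p : ℕ}
    (R : L.RestrictedStructure p) : Algebra K (RestrictedEnveloping R) :=
  RingQuot.instAlgebra (RestrictedEnvelopingRel R)

/-- The projection of `T(g)` to the restricted universal enveloping algebra. -/
noncomputable def RestrictedEnveloping.mk {L : LieSuperalgebra K g} {p : ℕ}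
    (R : L.RestrictedStructure p) : TensorAlgebra K g →ₐ[K] RestrictedEnveloping R :=
  RingQuot.mkAlgHom K (RestrictedEnvelopingRel R)

/-- The canonical map of `g` to its restricted universal enveloping algebra. -/
noncomputable def RestrictedEnveloping.ι {L : LieSuperalgebra K g} {p : ℕ}
    (R : L.RestrictedStructure p) : g →ₗ[K] RestrictedEnveloping R :=
  (RestrictedEnveloping.mk R).toLinearMap ∘ₗ TensorAlgebra.ι K

/-- The grading of the restricted universal enveloping algebra induced by a grading of `g`. -/
noncomputable def RestrictedEnveloping.grading {L : LieSuperalgebra K g} {p : ℕ}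
    (R : L.RestrictedStructure p) (𝒢 : ℤ → Submodule K g) : ℤ → Submodule K (RestrictedEnveloping R) :=
  generatedGrading K (fun k => RestrictedEnveloping.ι R '' (𝒢 k : Set g))

end Enveloping

end LieSuperalgebra

/-- The generators of the Steenrod algebra: `P^i` for `i ≥ 0` and, for `p ≠ 2` only, `β`.
For `p = 2` the generator `P^i` is `Sq^i`. -/
inductive SteenrodGen (p : ℕ) : Type
  | P (i : ℕ) : SteenrodGen p
  | beta (h : p ≠ 2) : SteenrodGen p

/-- `deg β = 1`; `deg P^i = 2i(p-1)` for `p ≠ 2` and `deg Sq^i = i`. -/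
def SteenrodGen.degree {p : ℕ} : SteenrodGen p → ℤ
  | .P i => if p = 2 then i else 2 * i * (p - 1)
  | .beta _ => 1

section Steenrod

variable (K : Type*) [Field K] (p : ℕ)

/-- The generator `P^i`, in the free algebra on the generators. -/
def freeP (i : ℕ) : FreeAlgebra K (SteenrodGen p) := FreeAlgebra.ι K (SteenrodGen.P i)

/-- The generator `β`, in the free algebra on the generators. -/
def freeBeta (h : p ≠ 2) : FreeAlgebra K (SteenrodGen p) :=
  FreeAlgebra.ι K (SteenrodGen.beta h)

/-- The defining relations of the Steenrod algebra over `K`, including `P^0 = c` for the scalar `c`.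
The subtractions of natural numbers below are never truncated: in `P_P` one has `i ≤ a / p < b`,
in the first sum of `P_beta_P` one has `i ≤ a / p ≤ b`, and in its second sum `p * i ≤ a - 1` and
`i < b`. -/
inductive SteenrodRel (c : K) :
    FreeAlgebra K (SteenrodGen p) → FreeAlgebra K (SteenrodGen p) → Prop
  | P_zero : SteenrodRel c (freeP K p 0) (algebraMap K _ c)
  | beta_sq (h : p ≠ 2) : SteenrodRel c (freeBeta K p h * freeBeta K p h) 0
  | P_P (a b : ℕ) (hab : a < p * b) :
      SteenrodRel c (freeP K p a * freeP K p b)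
        (∑ i ∈ Finset.range (a / p + 1),
          ((-1 : ℤ) ^ (a + i) * (((p - 1) * (b - i) - 1).choose (a - p * i) : ℤ)) •
            (freeP K p (a + b - i) * freeP K p i))
  | P_beta_P (h : p ≠ 2) (a b : ℕ) (hab : a ≤ p * b) :
      SteenrodRel c (freeP K p a * freeBeta K p h * freeP K p b)
        ((∑ i ∈ Finset.range (a / p + 1),
          ((-1 : ℤ) ^ (a + i) * (((p - 1) * (b - i)).choose (a - p * i) : ℤ)) •
            (freeBeta K p h * freeP K p (a + b - i) * freeP K p i)) -
        ∑ i ∈ (Finset.range a).filter (fun i => p * i + 1 ≤ a),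
          ((-1 : ℤ) ^ (a + i) * (((p - 1) * (b - i) - 1).choose (a - p * i - 1) : ℤ)) •
            (freeP K p (a + b - i) * freeBeta K p h * freeP K p i))

/-- The Steenrod algebra `𝔄(p)` over `K`, given by generators and Adem relations, where `P^0` is the
scalar `c`. -/
def SteenrodAlgebra (c : K) : Type _ := RingQuot (SteenrodRel K p c)

noncomputable instance SteenrodAlgebra.instRing (c : K) : Ring (SteenrodAlgebra K p c) :=
  RingQuot.instRing (SteenrodRel K p c)

noncomputable instance SteenrodAlgebra.instAlgebra (c : K) : Algebra K (SteenrodAlgebra K p c) :=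
  RingQuot.instAlgebra (SteenrodRel K p c)

/-- The projection of the free algebra to the Steenrod algebra. -/
noncomputable def SteenrodAlgebra.mk (c : K) :
    FreeAlgebra K (SteenrodGen p) →ₐ[K] SteenrodAlgebra K p c :=
  RingQuot.mkAlgHom K (SteenrodRel K p c)

/-- The image of a generator in the Steenrod algebra. -/
noncomputable def SteenrodAlgebra.gen (c : K) (s : SteenrodGen p) : SteenrodAlgebra K p c :=
  SteenrodAlgebra.mk K p c (FreeAlgebra.ι K s)

/-- The grading of the Steenrod algebra by the degree of the generators. -/
noncomputable def SteenrodAlgebra.grading (c : K) : ℤ → Submodule K (SteenrodAlgebra K p c) :=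
  generatedGrading K (fun k => SteenrodAlgebra.gen K p c '' {s | s.degree = k})

end Steenrod

/-- An isomorphism of `K`-algebras that preserves the given gradings. -/
def IsGradedIso {K : Type*} [Field K] {A B : Type*} [Ring A] [Algebra K A] [Ring B] [Algebra K B]
    (𝒜 : ℤ → Submodule K A) (ℬ : ℤ → Submodule K B) (f : A ≃ₐ[K] B) : Prop :=
  ∀ k : ℤ, (𝒜 k).map f.toLinearMap = ℬ k

/-! ### Gradings generated by homogeneous elements -/

section GeneratedGrading

variable {K : Type*} [Field K] {A : Type*} [Ring A] [Algebra K A]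

/-! An enveloping algebra admits tensor products of modules, on which `g` acts by the Leibniz rule
with signs. An isomorphism with the Steenrod algebra `A` would transport this to `A`. Tensoring a
small module `ρ : A → M₃(K)` with the regular module gives an algebra map `T : A → M₃(A)` with `T a
= ρ(a) + s^|a| a` for `a` in the image of `g`, where `s` is the parity operator (`exists_twist`,
`IsTwist`). Only the universal property is used: neither PBW nor injectivity of `g → U(g)` is
needed.

The formula for `T` holds in every positive degree where all products of elements of positive
degrees vanish, since such a degree is spanned by the image of `g` (`generatedGrading_le_span`).
This covers `x = Sq^1` or `β`, and `y = Sq^2` or `P^1`. For odd `p` and `c ≠ 0` it also covers `z =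
P^p`: below degree `|z|` everything is a word in `x`, `y`; the Serre relation puts such words in
normal form, and in degree `|z|` only `y^p = 0` survives (`mul_eq_zero_of_degree`).

The module `ρ` has a basis vector in each of degrees `0`, `1`, `1 + |y|`, joined by `x` and then
`y`, while `z` acts by zero. Apply `T` to an Adem consequence and compare the entries from the
bottom to the top vector. For `p = 2`, `c y² = x y x` gives `x = 0`, although `ρ(x) ≠ 0`. For odd
`p` and `c ≠ 0`, `y x y^(p-1) = (p-1)! c^(p-1) (z x - x z)` gives `y^(p-1) = 0`. But the entries `n
y^(n-1)` of `T(y)^n` show `y^n ≠ 0` for `n < p`, which also excludes `c = 0`, where `y² = 2c P^2 =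
0`. -/

theorem mem_generatedGrading {S : ℤ → Set A} {k : ℤ} {a : A} (ha : a ∈ S k) :
    a ∈ generatedGrading K S k :=
  Submodule.subset_span ⟨[(k, a)], by simpa using ha, by simp, by simp⟩

theorem generatedGrading_map {B : Type*} [Ring B] [Algebra K B] (f : A →ₐ[K] B) (S : ℤ → Set A)
    (k : ℤ) : (generatedGrading K S k).map f.toLinearMap =
      generatedGrading K (fun k => f '' S k) k := by
  unfold generatedGrading
  rw [Submodule.map_span]
  congr 1
  ext b
  constructor
  · rintro ⟨_, ⟨l, hl, hk, rfl⟩, rfl⟩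
    refine ⟨l.map (Prod.map id f), ?_, ?_, ?_⟩
    · intro q hq
      obtain ⟨r, hr, rfl⟩ := List.mem_map.1 hq
      exact ⟨r.2, hl r hr, rfl⟩
    · simpa [Function.comp_def] using hk
    · simp [map_list_prod, Function.comp_def]
  · rintro ⟨l, hl, hk, rfl⟩
    induction l generalizing k with
    | nil => exact ⟨1, ⟨[], by simp, hk, by simp⟩, by simp⟩
    | cons q l ih =>
      obtain ⟨a, ha, hqa⟩ := hl q (by simp)
      obtain ⟨_, ⟨l', hl', hk', rfl⟩, h⟩ := ih _ (fun r hr => hl r (by simp [hr])) rfl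
      refine ⟨_, ⟨(q.1, a) :: l', ?_, ?_, rfl⟩, ?_⟩
      · simp only [List.mem_cons, forall_eq_or_imp]
        exact ⟨ha, hl'⟩
      · simpa [hk'] using hk
      · simp only [AlgHom.toLinearMap_apply] at h
        simp [h, hqa]

/-- If all products of two elements of positive degrees of sum `n` vanish, and so do the
generators of degrees at most `0`, then the component of degree `n` is spanned by generators. -/
theorem generatedGrading_le_span {S : ℤ → Set A} (hS : ∀ k ≤ 0, ∀ a ∈ S k, a = 0) {n : ℤ}
    (hn : 0 < n) (h : ∀ d e : ℤ, 0 < d → 0 < e → d + e = n → ∀ a ∈ generatedGrading K S d,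
      ∀ b ∈ generatedGrading K S e, a * b = 0) :
    generatedGrading K S n ≤ Submodule.span K (S n) := by
  refine Submodule.span_le.2 ?_
  rintro _ ⟨l, hl, hk, rfl⟩
  match l with
  | [] => simp at hk; omega
  | [q] =>
    have hq := hl q (by simp)
    have : q.1 = n := by simpa using hk
    subst this
    simpa using Submodule.subset_span hq
  | q :: r :: l =>
    have hz : ((q :: r :: l).map Prod.snd).prod = 0 := by
      by_cases hpos : ∀ t ∈ q :: r :: l, 0 < t.1
      · have hq := hl q (by simp)
        rw [List.map_cons, List.prod_cons]
        refine h q.1 (((r :: l).map Prod.fst).sum) (hpos q (by simp)) ?_ (by simpa using hk) _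
          (mem_generatedGrading hq) _
          (Submodule.subset_span ⟨r :: l, fun t ht => hl t (by simp [ht]), rfl, rfl⟩)
        apply List.sum_pos
        · intro t ht
          obtain ⟨u, hu, rfl⟩ := List.mem_map.1 ht
          exact hpos u (List.mem_cons_of_mem _ hu)
        · simp
      · push Not at hpos
        obtain ⟨t, ht, ht0⟩ := hpos
        exact List.prod_eq_zero (List.mem_map.2 ⟨t, ht, hS _ ht0 _ (hl t ht)⟩)
    rw [hz]
    exact Submodule.zero_mem _

end GeneratedGrading

theorem add_pow_prime_of_commute (K : Type*) [Field K] {R : Type*} [Ring R] [Algebra K R] (p : ℕ)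
    [Fact p.Prime] [CharP K p] {a b : R} (h : Commute a b) : (a + b) ^ p = a ^ p + b ^ p := by
  cases subsingleton_or_nontrivial R
  · exact Subsingleton.elim _ _
  · have := charP_of_injective_algebraMap (algebraMap K R).injective p
    exact add_pow_char_of_commute p h

/-! ### Representations of Lie superalgebras and their twisted tensor products -/

namespace LieSuperalgebra

section Twist

variable {K : Type*} [Field K] {g : Type*} [AddCommGroup g] [Module K g]
  {R : Type*} [Ring R] [Algebra K R]

/-- A linear map to an associative algebra that satisfies the relations of `U(g)`. -/
structure IsRep (L : LieSuperalgebra K g) (τ : g →ₗ[K] R) : Prop where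
  bracket : ∀ {i j : ZMod 2} {x y : g}, x ∈ L.part i → y ∈ L.part j →
    τ x * τ y - superSign i j • (τ y * τ x) = τ (L.bracket x y)
  sq : ∀ x : L.part 1, τ x * τ x = τ (L.sq x)

theorem IsRep.exists_lift {L : LieSuperalgebra K g} {τ : g →ₗ[K] R} (h : L.IsRep τ) :
    ∃ T : L.Enveloping →ₐ[K] R, ∀ x, T (Enveloping.ι L x) = τ x := by
  refine ⟨RingQuot.liftAlgHom K ⟨TensorAlgebra.lift K τ, ?_⟩, fun x => ?_⟩
  · intro a b hab
    cases hab with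
    | bracket hx hy => simpa using h.bracket hx hy
    | sq x => simpa using h.sq x
  · exact (RingQuot.liftAlgHom_mkAlgHom_apply K _ _ _).trans (by simp)

theorem IsRep.exists_lift_restricted {L : LieSuperalgebra K g} {p : ℕ}
    (P : L.RestrictedStructure p) {τ : g →ₗ[K] R} (h : L.IsRep τ)
    (hp : ∀ x : L.part 0, τ x ^ p = τ (P.pmap x)) :
    ∃ T : RestrictedEnveloping P →ₐ[K] R, ∀ x, T (RestrictedEnveloping.ι P x) = τ x := by
  refine ⟨RingQuot.liftAlgHom K ⟨TensorAlgebra.lift K τ, ?_⟩, fun x => ?_⟩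
  · intro a b hab
    cases hab with
    | enveloping h' =>
      cases h' with
      | bracket hx hy => simpa using h.bracket hx hy
      | sq x => simpa using h.sq x
    | pmap x => simpa using hp x
  · exact (RingQuot.liftAlgHom_mkAlgHom_apply K _ _ _).trans (by simp)

theorem isRep_ι (L : LieSuperalgebra K g) : L.IsRep (Enveloping.ι L) where
  bracket hx hy := by
    have := RingQuot.mkAlgHom_rel K (EnvelopingRel.bracket (L := L) hx hy)
    rw [map_sub, map_zsmul, map_mul, map_mul] at this
    exact this
  sq x := by
    have := RingQuot.mkAlgHom_rel K (EnvelopingRel.sq (L := L) x)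
    rw [map_mul] at this
    exact this

theorem isRep_restricted_ι {L : LieSuperalgebra K g} {p : ℕ} (P : L.RestrictedStructure p) :
    L.IsRep (RestrictedEnveloping.ι P) where
  bracket hx hy := by
    have := RingQuot.mkAlgHom_rel K
      (RestrictedEnvelopingRel.enveloping (R := P) (EnvelopingRel.bracket hx hy))
    rw [map_sub, map_zsmul, map_mul, map_mul] at this
    exact this
  sq x := by
    have := RingQuot.mkAlgHom_rel K
      (RestrictedEnvelopingRel.enveloping (R := P) (EnvelopingRel.sq x))
    rw [map_mul] at this
    exact this

theorem restricted_ι_pow {L : LieSuperalgebra K g} {p : ℕ} (P : L.RestrictedStructure p)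
    (x : L.part 0) :
    RestrictedEnveloping.ι P x ^ p = RestrictedEnveloping.ι P (P.pmap x) := by
  have := RingQuot.mkAlgHom_rel K (RestrictedEnvelopingRel.pmap (R := P) x)
  rw [map_pow] at this
  exact this

theorem IsRep.comp {L : LieSuperalgebra K g} {τ : g →ₗ[K] R} (h : L.IsRep τ) {B : Type*} [Ring B]
    [Algebra K B] (f : R →ₐ[K] B) : L.IsRep (f.toLinearMap ∘ₗ τ) where
  bracket hx hy := by simpa using congrArg f (h.bracket hx hy)
  sq x := by simpa using congrArg f (h.sq x)

/-- The even and odd degrees together span `g`, and each sum lies in the corresponding part; since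
the two parts meet only in `0`, neither part can be larger. -/
theorem part_le_iSup (L : LieSuperalgebra K g) {𝒢 : ℤ → Submodule K g} (h : L.IsZGrading 𝒢)
    (i : ZMod 2) : L.part i ≤ ⨆ k : ℤ, ⨆ _ : (k : ZMod 2) = i, 𝒢 k := by
  set B : ZMod 2 → Submodule K g := fun i => ⨆ k : ℤ, ⨆ _ : (k : ZMod 2) = i, 𝒢 k
  have hB : ∀ i, B i ≤ L.part i := fun i => iSup₂_le fun k hk => hk ▸ h.parity k
  have htop : B i ⊔ B (i + 1) = ⊤ := by
    rw [eq_top_iff, ← h.isInternal.submodule_iSup_eq_top]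
    refine iSup_le fun k => ?_
    have : (k : ZMod 2) = i ∨ (k : ZMod 2) = i + 1 := by
      generalize (k : ZMod 2) = m; revert m i; decide
    rcases this with hk | hk
    · exact (le_iSup₂ (f := fun (k : ℤ) (_ : (k : ZMod 2) = i) => 𝒢 k) k hk).trans le_sup_left
    · exact (le_iSup₂ (f := fun (k : ℤ) (_ : (k : ZMod 2) = i + 1) => 𝒢 k) k hk).trans
        le_sup_right
  intro x hx
  obtain ⟨u, hu, v, hv, rfl⟩ := Submodule.mem_sup.1 (htop ▸ Submodule.mem_top : x ∈ B i ⊔ B (i + 1))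
  have hvi : v ∈ L.part i := by simpa using Submodule.sub_mem _ hx (hB i hu)
  have hne : i ≠ i + 1 := by simp
  have : v = 0 := Submodule.disjoint_def.1
    (L.isInternal.submodule_iSupIndep.pairwiseDisjoint hne) v hvi (hB _ hv)
  simpa [this] using hu

theorem exists_linearMap_eq_on_part (L : LieSuperalgebra K g) (F : ZMod 2 → g →ₗ[K] R) :
    ∃ τ : g →ₗ[K] R, ∀ i, ∀ x ∈ L.part i, τ x = F i x := by
  let e := LinearEquiv.ofBijective (DirectSum.coeLinearMap L.part) L.isInternal
  refine ⟨DirectSum.toModule K _ R (fun i => F i ∘ₗ (L.part i).subtype) ∘ₗ e.symm.toLinearMap, ?_⟩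
  intro i x hx
  have : e.symm x = DirectSum.lof K _ (fun i => L.part i) i ⟨x, hx⟩ := by
    rw [LinearEquiv.symm_apply_eq]
    exact (DirectSum.coeLinearMap_lof L.part i ⟨x, hx⟩).symm
  simp [this, DirectSum.toModule_lof]

/-- The element `s` or `1`, according to parity. -/
def signElt (s : R) (i : ZMod 2) : R := if i = 1 then s else 1

theorem zmod_two_cases (i : ZMod 2) : i = 0 ∨ i = 1 := by revert i; decide

/-- The tensor product of two representations with commuting images, twisted by `s` as the sign rule
demands. -/
theorem exists_twist (L : LieSuperalgebra K g) {ρ j : g →ₗ[K] R} (hρ : L.IsRep ρ) (hj : L.IsRep j)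
    (hcomm : ∀ x y, Commute (ρ x) (j y)) (s : R) (hs : s * s = 1) (hsj : ∀ x, Commute s (j x))
    (h0 : ∀ x ∈ L.part 0, s * ρ x = ρ x * s) (h1 : ∀ x ∈ L.part 1, s * ρ x = -(ρ x * s)) :
    ∃ τ : g →ₗ[K] R, L.IsRep τ ∧ ∀ i, ∀ x ∈ L.part i, τ x = ρ x + signElt s i * j x := by
  obtain ⟨τ, hτ⟩ := L.exists_linearMap_eq_on_part
    (fun i => ρ + LinearMap.mulLeft K (signElt s i) ∘ₗ j)
  replace hτ : ∀ i, ∀ x ∈ L.part i, τ x = ρ x + signElt s i * j x := fun i x hx => by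
    simpa using hτ i x hx
  refine ⟨τ, ⟨?_, ?_⟩, hτ⟩
  · intro a b x y hx hy
    rw [hτ _ _ hx, hτ _ _ hy, hτ _ _ (L.bracket_mem hx hy), ← hρ.bracket hx hy,
      ← hj.bracket hx hy]
    have c1 := (hcomm x y).eq
    have c2 := (hcomm y x).eq
    have c3 := (hsj x).eq
    have c4 := (hsj y).eq
    -- In all four parity cases the mixed terms cancel, the sign coming from moving `s` past an odd
    -- `ρ`; when both are odd, `s * s = 1` removes the twist from the product of the `j` terms.
    rcases zmod_two_cases a with rfl | rfl <;> rcases zmod_two_cases b with rfl | rfl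
    · simp only [signElt, superSign, zero_ne_one, false_and, if_false, one_mul, one_smul, add_zero]
      linear_combination (norm := noncomm_ring) c1 - c2
    · have e := h0 x hx
      simp only [signElt, superSign, zero_ne_one, false_and, if_false, if_true, one_mul, one_smul,
        zero_add]
      linear_combination (norm := noncomm_ring) s * c1 - e * j y - c2 - c3 * j y
    · have e := h0 y hy
      simp only [signElt, superSign, zero_ne_one, and_false, if_false, if_true, one_mul, one_smul,
        add_zero]
      linear_combination (norm := noncomm_ring) c1 + e * j x - s * c2 + c4 * j x
    · have e := h1 x hx
      have e' := h1 y hy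
      have h2 : (1 : ZMod 2) + 1 = 0 := rfl
      simp only [signElt, superSign, and_self, if_true, h2, zero_ne_one, if_false, one_mul,
        neg_smul, one_smul]
      linear_combination (norm := noncomm_ring) s * c1 * (-1) + e * j y + e' * j x - s * c2
        - s * c3 * j y - s * c4 * j x + hs * (j x * j y + j y * j x)
  · intro x
    rw [hτ _ _ x.2, hτ _ _ (L.sq x).2, ← hρ.sq, ← hj.sq]
    have c1 := (hcomm x x).eq
    have c3 := (hsj x).eq
    have e := h1 x x.2
    simp only [signElt, if_true, zero_ne_one, if_false, one_mul]
    linear_combination (norm := noncomm_ring) e * j x - s * c1 - s * c3 * j x + hs * (j x * j x)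

end Twist

end LieSuperalgebra
-- The three-dimensional test module
namespace SteenrodAlgebra

section Rep

variable (K : Type*) [Field K] (p : ℕ)

/-- The index of the lowest operation `P^i` that is not a scalar and not of degree one. -/
def lowIndex : ℕ := if p = 2 then 2 else 1

/-- The operators on a module with basis in degrees `0`, `1` and `1 + m`, where `m` is the degree of
`P^1` (or of `Sq^2`). -/
def lowRepP (c : K) (i : ℕ) : Matrix (Fin 3) (Fin 3) K :=
  if i = 0 then !![c, 0, 0; 0, c, 0; 0, 0, c]
  else if i = lowIndex p then !![0, 0, 0; 0, 0, 0; 0, 1, 0]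
  else if i = 1 then !![0, 0, 0; 1, 0, 0; 0, 0, 0]
  else 0

/-- The operator of degree one. -/
def lowRepBeta : Matrix (Fin 3) (Fin 3) K := !![0, 0, 0; 1, 0, 0; 0, 0, 0]

theorem lowRepP_zero (c : K) : lowRepP K p c 0 = algebraMap K _ c := by
  ext i j
  fin_cases i <;> fin_cases j <;> simp [lowRepP, Matrix.algebraMap_matrix_apply]

variable {K p}

theorem lowRepP_eq_zero (c : K) {i : ℕ} (hi : 3 ≤ i) : lowRepP K p c i = 0 := by
  have h1 : i ≠ lowIndex p := by unfold lowIndex; split_ifs <;> omega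
  rw [lowRepP, if_neg (by omega), if_neg h1, if_neg (by omega)]

theorem lowRepP_mul_eq_zero (c : K) {i j : ℕ} (hi : 0 < i) (hj : 0 < j)
    (h : ¬ (p = 2 ∧ i = 2 ∧ j = 1)) : lowRepP K p c i * lowRepP K p c j = 0 := by
  ext a b
  simp only [lowRepP, lowIndex, if_neg hi.ne', if_neg hj.ne']
  split_ifs <;> first | omega | (fin_cases a <;> fin_cases b <;>
    simp [Matrix.mul_apply, Fin.sum_univ_three])

theorem lowRepP_of_ne_two (hp : p ≠ 2) (c : K) {i : ℕ} (hi : 2 ≤ i) : lowRepP K p c i = 0 := by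
  rw [lowRepP, lowIndex, if_neg hp, if_neg (by omega), if_neg (by omega), if_neg (by omega)]

theorem lowRepBeta_mul_lowRepP (hp : p ≠ 2) (c : K) {i : ℕ} (hi : 0 < i) :
    lowRepBeta K * lowRepP K p c i = 0 := by
  ext a b
  simp only [lowRepP, lowIndex, if_neg hi.ne', lowRepBeta, if_neg hp]
  split_ifs <;> fin_cases a <;> fin_cases b <;> simp [Matrix.mul_apply, Fin.sum_univ_three]

variable (p)

/-- Apart from the scalar `P^0`, the only products of two generators acting nontrivially are `Sq^2
Sq^1` and `P^1 β`. The former is admissible, and neither the left nor the right sides of the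
relations force it to vanish. -/
theorem exists_lowRep [Fact p.Prime] (c : K) :
    ∃ ρ : SteenrodAlgebra K p c →ₐ[K] Matrix (Fin 3) (Fin 3) K,
      (∀ i, ρ (gen K p c (.P i)) = lowRepP K p c i) ∧
      ∀ h, ρ (gen K p c (.beta h)) = lowRepBeta K := by
  let F : FreeAlgebra K (SteenrodGen p) →ₐ[K] Matrix (Fin 3) (Fin 3) K :=
    FreeAlgebra.lift K (fun s => match s with
      | .P i => lowRepP K p c i
      | .beta _ => lowRepBeta K)
  have hFP : ∀ i, F (freeP K p i) = lowRepP K p c i := fun i => by simp [F, freeP]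
  have hFB : ∀ h, F (freeBeta K p h) = lowRepBeta K := fun i => by simp [F, freeBeta]
  have hp : 2 ≤ p := (Fact.out : p.Prime).two_le
  refine ⟨RingQuot.liftAlgHom K ⟨F, ?_⟩,
    fun i => (RingQuot.liftAlgHom_mkAlgHom_apply K _ _ _).trans (hFP i),
    fun h => (RingQuot.liftAlgHom_mkAlgHom_apply K _ _ _).trans (hFB h)⟩
  intro u v huv
  cases huv with
  | P_zero => rw [hFP, lowRepP_zero, AlgHom.commutes]
  | beta_sq h =>
    rw [map_mul, hFB, map_zero]
    ext a b
    fin_cases a <;> fin_cases b <;> simp [lowRepBeta, Matrix.mul_apply, Fin.sum_univ_three]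
  | P_P a b hab =>
    simp only [map_mul, map_sum, map_zsmul, hFP]
    have hb : 0 < b := Nat.pos_of_ne_zero (by rintro rfl; simp at hab)
    rcases Nat.eq_zero_or_pos a with rfl | ha
    · simp [lowRepP_zero, Algebra.commutes]
    · have hdiv : a / p < b := Nat.div_lt_of_lt_mul hab
      rw [lowRepP_mul_eq_zero c ha hb (by rintro ⟨rfl, rfl, rfl⟩; omega)]
      symm
      refine Finset.sum_eq_zero fun i hi => ?_
      rw [Finset.mem_range] at hi
      rcases Nat.eq_zero_or_pos i with rfl | hi0
      · by_cases h3 : 3 ≤ a + b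
        · rw [Nat.sub_zero (a + b), lowRepP_eq_zero c h3, zero_mul, smul_zero]
        · obtain rfl : a = 1 := by omega
          obtain rfl : b = 1 := by omega
          -- For `p = 2` the operator `Sq^2` is nonzero, but its coefficient in `Sq^1 Sq^1` is the
          -- binomial of `0` over `1`.
          by_cases h2 : p = 2
          · subst h2; simp
          · rw [lowRepP_of_ne_two h2 c (by norm_num), zero_mul, smul_zero]
      · rw [lowRepP_mul_eq_zero c (by omega) hi0, smul_zero]
        -- A term `Sq^2 Sq^1` on the right would need `a = 2`, `b = 1`, against `a < 2 * b`.
        rintro ⟨hp2, h1, rfl⟩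
        rw [hp2] at hab
        have : a / p ≥ 1 := by omega
        have : p ≤ a := (Nat.one_le_div_iff (by omega)).1 this
        obtain rfl : a = 2 := by omega
        obtain rfl : b = 1 := by omega
        omega
  | P_beta_P h a b hab =>
    simp only [map_mul, map_sub, map_sum, map_zsmul, hFP, hFB]
    rcases Nat.eq_zero_or_pos a with rfl | ha
    · simp [lowRepP_zero, Algebra.commutes, mul_assoc]
    · have hb : 0 < b := Nat.pos_of_ne_zero (by rintro rfl; omega)
      have hdiv : a / p ≤ b := Nat.div_le_of_le_mul hab
      rw [mul_assoc, lowRepBeta_mul_lowRepP h c hb, mul_zero, Finset.sum_eq_zero,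
        Finset.sum_eq_zero, sub_zero]
      · intro i hi
        rw [mul_assoc]
        rcases Nat.eq_zero_or_pos i with rfl | hi0
        · rw [Nat.sub_zero, lowRepP_of_ne_two h c (by omega), zero_mul, smul_zero]
        · rw [lowRepBeta_mul_lowRepP h c hi0, mul_zero, smul_zero]
      · intro i hi
        rw [Finset.mem_range] at hi
        rw [lowRepBeta_mul_lowRepP h c (by omega), zero_mul, smul_zero]

end Rep

end SteenrodAlgebra

/-- The relations of the Steenrod algebra, for a family of elements of an algebra. -/
structure AdemRelations {K : Type*} [Field K] {p : ℕ} (c : K) {A : Type*} [Ring A] [Algebra K A]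
    (e : SteenrodGen p → A) : Prop where
  P_zero : e (.P 0) = algebraMap K A c
  beta_mul_self (h : p ≠ 2) : e (.beta h) * e (.beta h) = 0
  P_mul_P (a b : ℕ) (hab : a < p * b) :
    e (.P a) * e (.P b) = ∑ i ∈ Finset.range (a / p + 1),
      ((-1 : ℤ) ^ (a + i) * (((p - 1) * (b - i) - 1).choose (a - p * i) : ℤ)) •
        (e (.P (a + b - i)) * e (.P i))
  P_mul_beta_mul_P (h : p ≠ 2) (a b : ℕ) (hab : a ≤ p * b) :
    e (.P a) * e (.beta h) * e (.P b) =
      (∑ i ∈ Finset.range (a / p + 1),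
          ((-1 : ℤ) ^ (a + i) * (((p - 1) * (b - i)).choose (a - p * i) : ℤ)) •
            (e (.beta h) * e (.P (a + b - i)) * e (.P i))) -
        ∑ i ∈ (Finset.range a).filter (fun i => p * i + 1 ≤ a),
          ((-1 : ℤ) ^ (a + i) * (((p - 1) * (b - i) - 1).choose (a - p * i - 1) : ℤ)) •
            (e (.P (a + b - i)) * e (.beta h) * e (.P i))

theorem SteenrodAlgebra.ademRelations (K : Type*) [Field K] (p : ℕ) (c : K) :
    AdemRelations c (gen K p c) := by
  have mk_eq : ∀ {a b : FreeAlgebra K (SteenrodGen p)}, SteenrodRel K p c a b →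
    mk K p c a = mk K p c b := fun h => RingQuot.mkAlgHom_rel K h
  have mk_freeP : ∀ i, mk K p c (freeP K p i) = gen K p c (.P i) := fun _ => rfl
  have mk_freeBeta : ∀ h, mk K p c (freeBeta K p h) = gen K p c (.beta h) := fun _ => rfl
  refine ⟨?_, fun h => ?_, fun a b hab => ?_, fun h a b hab => ?_⟩
  · rw [← mk_freeP, mk_eq .P_zero, AlgHom.commutes]
  · rw [← mk_freeBeta, ← map_mul, mk_eq (.beta_sq h), map_zero]
  · simpa only [map_mul, map_sum, map_zsmul, mk_freeP] using mk_eq (.P_P a b hab)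
  · simpa only [map_mul, map_sub, map_sum, map_zsmul, mk_freeP, mk_freeBeta] using
      mk_eq (.P_beta_P h a b hab)

/-! ### Consequences of the Adem relations -/

namespace AdemRelations

section Two

variable {K : Type*} [Field K] {c : K} {A : Type*} [Ring A] [Algebra K A] {e : SteenrodGen 2 → A}

theorem sq_one_mul_self (H : AdemRelations c e) : e (.P 1) * e (.P 1) = 0 := by
  rw [H.P_mul_P 1 1 (by norm_num)]
  simp

/-- Both sides equal `c Sq^3 Sq^1`, because `Sq^1 Sq^2 = c Sq^3` and `Sq^2 Sq^2 = Sq^3 Sq^1`. -/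
theorem sq_two_relation (H : AdemRelations c e) :
    c • (e (.P 2) * e (.P 2)) = e (.P 1) * e (.P 2) * e (.P 1) := by
  have h1 := H.P_mul_P 1 2 (by norm_num)
  have h2 := H.P_mul_P 2 2 (by norm_num)
  norm_num [Finset.sum_range_succ, H.P_zero] at h1 h2
  rw [h1, h2, ← Algebra.commutes, ← Algebra.smul_def]
  simp

end Two

section Odd

variable {K : Type*} [Field K] {p : ℕ} {c : K} {A : Type*} [Ring A] [Algebra K A]
  {e : SteenrodGen p → A} [Fact p.Prime] [CharP K p]

theorem cast_pred_mul_add (k : ℕ) : (((p - 1) * k : ℕ) : K) = -k := by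
  have : 1 ≤ p := (Fact.out : p.Prime).one_le
  push_cast [Nat.cast_sub this]
  simp

theorem P_one_mul (H : AdemRelations c e) (h : p ≠ 2) {k : ℕ} (hk : 0 < k) :
    e (.P 1) * e (.P k) = (((k + 1 : ℕ) : K) * c) • e (.P (k + 1)) := by
  have hp : 2 < p := lt_of_le_of_ne (Fact.out : p.Prime).two_le (Ne.symm h)
  rw [H.P_mul_P 1 k (by nlinarith), Nat.div_eq_of_lt (by omega)]
  have h1 : 1 ≤ (p - 1) * k := Nat.mul_pos (by omega) hk
  simp only [zero_add, Finset.sum_range_one, add_zero, pow_one, Nat.sub_zero, mul_zero,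
    Nat.choose_one_right, H.P_zero]
  rw [← Algebra.commutes, ← Algebra.smul_def, ← Int.cast_smul_eq_zsmul K, smul_smul, add_comm 1 k]
  congr 2
  push_cast [Nat.cast_sub h1]
  have := cast_pred_mul_add (K := K) (p := p) k
  push_cast at this
  rw [this]; ring

theorem P_one_pow (H : AdemRelations c e) (h : p ≠ 2) (k : ℕ) : e (.P 1) ^ (k + 1) =
    ((((k + 1).factorial : ℕ) : K) * c ^ k) • e (.P (k + 1)) := by
  induction k with
  | zero => simp
  | succ k ih =>
    rw [pow_succ', ih, mul_smul_comm, H.P_one_mul h (by omega), smul_smul]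
    congr 1
    rw [Nat.factorial_succ (k + 1)]
    push_cast; ring

theorem P_one_pow_char (H : AdemRelations c e) (h : p ≠ 2) : e (.P 1) ^ p = 0 := by
  have hp := (Fact.out : p.Prime).pos
  obtain ⟨k, rfl⟩ : ∃ k, p = k + 1 := ⟨p - 1, by omega⟩
  rw [H.P_one_pow h, Nat.factorial_succ, Nat.cast_mul, CharP.cast_eq_zero]
  simp

theorem P_one_mul_beta_mul (H : AdemRelations c e) (h : p ≠ 2) {k : ℕ} (hk : 0 < k) :
    e (.P 1) * e (.beta h) * e (.P k) =
      c • ((k : K) • (e (.beta h) * e (.P (k + 1))) +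
        e (.P (k + 1)) * e (.beta h)) := by
  have hp : 2 < p := lt_of_le_of_ne (Fact.out : p.Prime).two_le (Ne.symm h)
  rw [H.P_mul_beta_mul_P h 1 k (by nlinarith), Nat.div_eq_of_lt (by omega),
    Finset.filter_true_of_mem (by simp)]
  simp only [zero_add, Finset.sum_range_one, add_zero, pow_one, Nat.sub_zero, mul_zero,
    Nat.choose_one_right, H.P_zero, Nat.sub_self, Nat.choose_zero_right]
  rw [← Algebra.commutes, ← Algebra.smul_def, ← Algebra.commutes, ← Algebra.smul_def,
    ← Int.cast_smul_eq_zsmul K, ← Int.cast_smul_eq_zsmul K, add_comm 1 k]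
  have := cast_pred_mul_add (K := K) (p := p) k
  push_cast at this ⊢
  rw [this]
  module

/-- Here `y² = 2c P^2` and `y x y = c (β P^2 + P^2 β)`. -/
theorem serre_relation (H : AdemRelations c e) (h : p ≠ 2) :
    let x := e (.beta h); let y := e (.P 1)
    y * y * x + x * y * y = 2 * (y * x * y) := by
  intro x y
  have h1 : y * y = _ := H.P_one_mul h one_pos
  have h2 : y * x * y = _ := H.P_one_mul_beta_mul h one_pos
  rw [h2, mul_assoc x, h1, two_mul]
  simp only [mul_smul_comm, smul_mul_assoc]
  push_cast
  module

/-- The relation for `P^1 β P^(p-1)` has coefficient `p - 1 = -1` in `K` at `β P^p`, hence a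
commutator; `P^(p-1)` enters through `y^(p-1) = (p-1)! c^(p-2) P^(p-1)`. -/
theorem beta_P_relation (H : AdemRelations c e) (h : p ≠ 2) :
    let x := e (.beta h); let y := e (.P 1); let z := e (.P p)
    y * x * y ^ (p - 1) = (((p - 1).factorial : K) * c ^ (p - 1)) • (z * x - x * z) := by
  intro x y z
  have hp : 2 < p := lt_of_le_of_ne (Fact.out : p.Prime).two_le (Ne.symm h)
  have h1 := H.P_one_pow h (p - 2)
  have h2 := H.P_one_mul_beta_mul h (k := p - 1) (by omega)
  rw [show p - 2 + 1 = p - 1 by omega] at h1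
  rw [show p - 1 + 1 = p by omega, Nat.cast_sub (by omega), CharP.cast_eq_zero] at h2
  rw [h1, mul_smul_comm, h2, show p - 1 = p - 2 + 1 by omega, pow_succ]
  push_cast
  module

end Odd

end AdemRelations
-- Degrees of the generators
namespace SteenrodGen

/-- The generator of degree one. -/
def bottom (p : ℕ) : SteenrodGen p := if h : p = 2 then .P 1 else .beta h

/-- The degree of `P^1`, or of `Sq^2`. -/
def lowDegree (p : ℕ) : ℤ := if p = 2 then 2 else 2 * (p - 1)

theorem degree_bottom (p : ℕ) : (bottom p).degree = 1 := by
  unfold bottom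
  split_ifs with h
  · simp [degree, h]
  · rfl

theorem degree_P_lowIndex (p : ℕ) : (P (SteenrodAlgebra.lowIndex p) : SteenrodGen p).degree =
    lowDegree p := by
  unfold SteenrodAlgebra.lowIndex degree lowDegree
  split_ifs <;> simp

variable {p : ℕ} [Fact p.Prime]

theorem two_le_lowDegree : 2 ≤ lowDegree p := by
  have := (Fact.out : p.Prime).two_le
  unfold lowDegree
  split_ifs <;> omega

theorem degree_nonneg (s : SteenrodGen p) : 0 ≤ s.degree := by
  have := (Fact.out : p.Prime).two_le
  cases s with
  | P i =>
    unfold degree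
    dsimp only
    split_ifs
    · positivity
    · exact mul_nonneg (by positivity) (by omega)
  | beta h => exact zero_le_one

theorem eq_of_degree_lt {s : SteenrodGen p} (h : s.degree < lowDegree p) :
    s = .P 0 ∨ s = bottom p := by
  have := (Fact.out : p.Prime).two_le
  cases s with
  | P i =>
    simp only [degree, lowDegree, bottom] at h ⊢
    split_ifs at h ⊢ with h2
    · have : i = 0 ∨ i = 1 := by omega
      simpa using this
    · left
      have : i = 0 := by
        by_contra hi
        have h3 : (1 : ℤ) ≤ i := by omega
        have h4 : (1 : ℤ) ≤ (p : ℤ) - 1 := by omega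
        nlinarith
      rw [this]
  | beta h2 => right; rw [bottom, dif_neg h2]

end SteenrodGen

/-- The grading for which the elements `e s` have the degrees of the generators `s` of the
Steenrod algebra. -/
noncomputable def steenrodGrading (K : Type*) [Field K] {p : ℕ} {A : Type*} [Ring A] [Algebra K A]
    (e : SteenrodGen p → A) : ℤ → Submodule K A :=
  generatedGrading K (fun k => e '' {s | s.degree = k})

/-! ### Homogeneous components in low degrees -/

section Homogeneous

variable {K : Type*} [Field K] {p : ℕ} {A : Type*} [Ring A] [Algebra K A] {e : SteenrodGen p → A}

theorem gen_mem_steenrodGrading (s : SteenrodGen p) : e s ∈ steenrodGrading K e s.degree :=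
  mem_generatedGrading ⟨s, rfl, rfl⟩

/-- Induction over the products of generators. -/
theorem steenrodGrading_induction {C : ℤ → Submodule K A} (h1 : 1 ∈ C 0)
    (hmul : ∀ s k, ∀ a ∈ C k, e s * a ∈ C (s.degree + k)) (k : ℤ) :
    steenrodGrading K e k ≤ C k := by
  refine Submodule.span_le.2 ?_
  rintro _ ⟨l, hl, rfl, rfl⟩
  induction l with
  | nil => simpa using h1
  | cons q l ih =>
    obtain ⟨s, hs, hq⟩ := hl q (by simp)
    have := hmul s _ _ (ih fun r hr => hl r (by simp [hr]))
    simp only [Set.mem_ofPred_eq] at hs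
    simpa only [List.map_cons, List.sum_cons, List.prod_cons, ← hq, ← hs, SetLike.mem_coe] using this

/-- Supercommutation with an element holds for all homogeneous elements if it does for the
generators. -/
theorem supercommute_of_mem_steenrodGrading {R : Type*} [Ring R] [Algebra K R] (ρ : A →ₐ[K] R)
    (s : R) (hs : ∀ t, s * ρ (e t) = (t.degree.negOnePow : ℤ) • (ρ (e t) * s)) {k : ℤ} {a : A}
    (ha : a ∈ steenrodGrading K e k) : s * ρ a = (k.negOnePow : ℤ) • (ρ a * s) := by
  let C : ℤ → Submodule K A := fun k => LinearMap.ker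
    ((LinearMap.mulLeft K s - (k.negOnePow : ℤ) • LinearMap.mulRight K s) ∘ₗ ρ.toLinearMap)
  have hC : ∀ k a, a ∈ C k ↔ s * ρ a = (k.negOnePow : ℤ) • (ρ a * s) := fun k a => by
    simp only [C, LinearMap.mem_ker, LinearMap.comp_apply, LinearMap.sub_apply,
      LinearMap.smul_apply, AlgHom.toLinearMap_apply, LinearMap.mulLeft_apply,
      LinearMap.mulRight_apply, sub_eq_zero]
  refine (hC k a).1 (steenrodGrading_induction ?_ ?_ k ha)
  · simp [hC]
  · intro t k b hb
    rw [hC] at hb ⊢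
    rw [map_mul, ← mul_assoc, hs, smul_mul_assoc, mul_assoc, hb, mul_smul_comm, smul_smul,
      Int.negOnePow_add, Units.val_mul, mul_assoc]

variable [Fact p.Prime]

theorem eq_zero_of_mem_steenrodGrading_neg {k : ℤ} (hk : k < 0) {a : A}
    (ha : a ∈ steenrodGrading K e k) : a = 0 := by
  have := steenrodGrading_induction (C := fun k => if k < 0 then ⊥ else ⊤) (by simp) ?_ k ha
  · simpa [hk] using this
  · intro s k a ha
    have := s.degree_nonneg
    split_ifs with h
    · rw [if_pos (by omega)] at ha
      simp_all
    · trivial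

/-- Below `lowDegree` the only generators are the scalar `P^0` and the one of degree one. -/
theorem AdemRelations.mem_span_pow {c : K} (H : AdemRelations c e) {d : ℕ}
    (hd : d < SteenrodGen.lowDegree p) {a : A} (ha : a ∈ steenrodGrading K e d) :
    a ∈ Submodule.span K {e (.bottom p) ^ d} := by
  -- The claim is made only in the relevant range: no generator has negative degree, so a short word
  -- never has a suffix of larger degree.
  let C : ℤ → Submodule K A := fun k => if k < 0 then ⊥ else if k < SteenrodGen.lowDegree p then
    Submodule.span K {e (.bottom p) ^ k.toNat} else ⊤
  have := steenrodGrading_induction (e := e) (C := C) ?_ ?_ d ha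
  · simpa [C, hd, not_lt.2 (Int.natCast_nonneg d)] using this
  · have : 0 < SteenrodGen.lowDegree p := by
      have := SteenrodGen.two_le_lowDegree (p := p); omega
    simp only [C, this, lt_irrefl, if_true, if_false, Int.toNat_zero, pow_zero]
    exact Submodule.mem_span_singleton_self _
  · intro s k a ha
    have h0 := s.degree_nonneg
    simp only [C] at ha ⊢
    by_cases hk : k < 0
    · rw [if_pos hk, Submodule.mem_bot] at ha
      rw [ha, mul_zero]
      exact Submodule.zero_mem _
    · rw [if_neg (show ¬ s.degree + k < 0 by omega)]
      split_ifs with hm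
      · rw [if_neg hk, if_pos (by omega)] at ha
        obtain ⟨r, rfl⟩ := Submodule.mem_span_singleton.1 ha
        rcases SteenrodGen.eq_of_degree_lt (s := s) (by omega) with rfl | rfl
        · have : (SteenrodGen.P 0 : SteenrodGen p).degree = 0 := by simp [SteenrodGen.degree]
          rw [H.P_zero, this, zero_add, ← Algebra.smul_def]
          exact Submodule.smul_mem _ _ (Submodule.smul_mem _ _ (Submodule.mem_span_singleton_self _))
        · have : (1 + k).toNat = k.toNat + 1 := by omega
          rw [SteenrodGen.degree_bottom, this, pow_succ', mul_smul_comm]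
          exact Submodule.smul_mem _ _ (Submodule.mem_span_singleton_self _)
      · trivial

theorem AdemRelations.bottom_mul_self {c : K} (H : AdemRelations c e) :
    e (.bottom p) * e (.bottom p) = 0 := by
  by_cases h : p = 2
  · subst h
    exact H.sq_one_mul_self
  · simpa [SteenrodGen.bottom, h] using H.beta_mul_self h

theorem AdemRelations.mul_eq_zero_of_lowDegree {c : K} (H : AdemRelations c e) {d d' : ℤ}
    (hd : 0 < d) (hd' : 0 < d') (h : d + d' = SteenrodGen.lowDegree p) {a b : A}
    (ha : a ∈ steenrodGrading K e d) (hb : b ∈ steenrodGrading K e d') : a * b = 0 := by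
  lift d to ℕ using hd.le
  lift d' to ℕ using hd'.le
  obtain ⟨r, rfl⟩ := Submodule.mem_span_singleton.1 (H.mem_span_pow (by omega) ha)
  obtain ⟨r', rfl⟩ := Submodule.mem_span_singleton.1 (H.mem_span_pow (by omega) hb)
  have : e (.bottom p) ^ d * e (.bottom p) ^ d' = 0 := by
    rw [← pow_add, show d + d' = 2 + (d + d' - 2) by omega, pow_add, pow_two, H.bottom_mul_self,
      zero_mul]
  rw [smul_mul_smul_comm, this, smul_zero]

end Homogeneous

/-! ### Normal forms of words in `β` and `P^1` for odd `p` -/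

section OddSpan

variable {K : Type*} [Field K] {p : ℕ} {c : K} {A : Type*} [Ring A] [Algebra K A]

/-- The span of the elements `y^i x^u w^v` of degree `d`, where `u, v ≤ 1` and `w = y x - x y`; here
`x` has degree `1` and `y` has degree `m`. -/
def wordSpan (K : Type*) [Field K] {A : Type*} [Ring A] [Algebra K A] (x y : A) (m d : ℤ) :
    Submodule K A :=
  Submodule.span K {a | ∃ i u v : ℕ, u ≤ 1 ∧ v ≤ 1 ∧ i * m + u + v * (m + 1) = d ∧
    y ^ i * x ^ u * (y * x - x * y) ^ v = a}

theorem mul_y_mem_wordSpan {x y : A} {m d : ℤ} {a : A} (ha : a ∈ wordSpan K x y m d) :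
    y * a ∈ wordSpan K x y m (m + d) := by
  suffices wordSpan K x y m d ≤ (wordSpan K x y m (m + d)).comap (LinearMap.mulLeft K y) from
    this ha
  refine Submodule.span_le.2 ?_
  rintro _ ⟨i, u, v, hu, hv, rfl, rfl⟩
  refine Submodule.subset_span ⟨i + 1, u, v, hu, hv, ?_, ?_⟩
  · push_cast; ring
  · simp only [pow_succ', LinearMap.mulLeft_apply, mul_assoc]

theorem mul_y_pow_mem_wordSpan {x y : A} {m d : ℤ} {a : A} (ha : a ∈ wordSpan K x y m d) (n : ℕ) :
    y ^ n * a ∈ wordSpan K x y m (n * m + d) := by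
  induction n with
  | zero => simpa using ha
  | succ n ih =>
    have := mul_y_mem_wordSpan ih
    rw [← mul_assoc, ← pow_succ', ← add_assoc] at this
    convert this using 2
    push_cast; ring

theorem commute_of_serre {x y : A} (hs : y * y * x + x * y * y = 2 * (y * x * y)) :
    Commute y (y * x - x * y) := by
  rw [commute_iff_eq]
  linear_combination (norm := noncomm_ring) hs

theorem mul_pow_of_serre {x y : A} (hs : y * y * x + x * y * y = 2 * (y * x * y)) (n : ℕ) :
    x * y ^ n = y ^ n * x - (n : A) * (y ^ (n - 1) * (y * x - x * y)) := by
  have hc := commute_of_serre hs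
  induction n with
  | zero => simp
  | succ n ih =>
    have h1 := (hc.pow_left n).eq
    have h2 : (n : A) * (y ^ (n - 1) * (y * x - x * y)) * y = n * (y ^ n * (y * x - x * y)) := by
      rcases n with _ | n
      · simp
      · rw [mul_assoc, mul_assoc, ← hc.eq, ← mul_assoc (y ^ _), Nat.add_sub_cancel, ← pow_succ]
    rw [pow_succ, ← mul_assoc, ih, sub_mul, h2, Nat.add_sub_cancel]
    push_cast
    noncomm_ring

theorem anticommute_of_sq_eq_zero {x : A} (hx : x * x = 0) (y : A) :
    x * (y * x - x * y) = -((y * x - x * y) * x) := by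
  linear_combination (norm := noncomm_ring) -hx * y + y * hx

/-- With `w = y x - x y`, expanding one factor in `w w + w w` and using that `w` commutes with `y`
and anticommutes with `x` gives `2 w² = 0`. -/
theorem commutator_mul_self {x y : A} (h2 : (2 : K) ≠ 0) (hx : x * x = 0)
    (hs : y * y * x + x * y * y = 2 * (y * x * y)) :
    (y * x - x * y) * (y * x - x * y) = 0 := by
  have hc := (commute_of_serre hs).eq
  have ha := anticommute_of_sq_eq_zero hx y
  have hd : (2 : K) • ((y * x - x * y) * (y * x - x * y)) = 0 := by
    rw [two_smul]
    generalize hw : y * x - x * y = w at *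
    have : w * w + w * w = w * (y * x - x * y) + (y * x - x * y) * w := by rw [hw]
    rw [this]
    linear_combination (norm := noncomm_ring) -hc * x + y * ha - x * hc - ha * y
  exact (smul_eq_zero.1 hd).resolve_left h2

theorem mul_x_mem_wordSpan {x y : A} (h2 : (2 : K) ≠ 0) (hx : x * x = 0)
    (hs : y * y * x + x * y * y = 2 * (y * x * y)) {m d : ℤ} {a : A}
    (ha : a ∈ wordSpan K x y m d) : x * a ∈ wordSpan K x y m (1 + d) := by
  suffices wordSpan K x y m d ≤ (wordSpan K x y m (1 + d)).comap (LinearMap.mulLeft K x) from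
    this ha
  refine Submodule.span_le.2 ?_
  rintro _ ⟨i, u, v, hu, hv, rfl, rfl⟩
  have hw := commutator_mul_self h2 hx hs
  have hxw := anticommute_of_sq_eq_zero hx y
  have hp := mul_pow_of_serre hs i
  change x * (y ^ i * x ^ u * (y * x - x * y) ^ v) ∈ wordSpan K x y m _
  have hmem : ∀ j u v : ℕ, u ≤ 1 → v ≤ 1 → ∀ d : ℤ, j * m + u + v * (m + 1) = d →
      y ^ j * x ^ u * (y * x - x * y) ^ v ∈ wordSpan K x y m d := fun j u v hu hv d h =>
    Submodule.subset_span ⟨j, u, v, hu, hv, h, rfl⟩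
  have hcast : ∀ (j : ℕ) {d : ℤ} {b : A}, b ∈ wordSpan K x y m d →
      (j : A) * b ∈ wordSpan K x y m d := fun j d b hb => by
    rw [← nsmul_eq_mul]
    exact Submodule.smul_of_tower_mem _ _ hb
  -- After moving `x` past `y^i`, the rules `x² = 0`, `w² = 0`, `x w = -w x` restore the normal form
  -- in each case.
  rw [← mul_assoc, ← mul_assoc, hp]
  generalize hW : y * x - x * y = w at *
  obtain rfl | rfl : u = 0 ∨ u = 1 := by omega
  · obtain rfl | rfl : v = 0 ∨ v = 1 := by omega
    · simp only [pow_zero, mul_one]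
      refine Submodule.sub_mem _ ?_ ?_
      · simpa using hmem i 1 0 (by simp) (by simp) _ (by push_cast; ring)
      · rcases i with _ | i
        · simp
        · refine hcast _ ?_
          simpa using hmem i 0 1 (by simp) (by simp) _ (by push_cast; ring)
    · have : (y ^ i * x - (i : A) * (y ^ (i - 1) * w)) * x ^ 0 * w ^ 1 = y ^ i * x ^ 1 * w ^ 1 := by
        linear_combination (norm := noncomm_ring) -((i : A) * y ^ (i - 1)) * hw
      rw [this]
      exact hmem i 1 1 (by simp) (by simp) _ (by push_cast; ring)
  · obtain rfl | rfl : v = 0 ∨ v = 1 := by omega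
    · have : (y ^ i * x - (i : A) * (y ^ (i - 1) * w)) * x ^ 1 * w ^ 0 =
          (i : A) * (y ^ (i - 1) * x ^ 1 * w ^ 1) := by
        linear_combination (norm := noncomm_ring) y ^ i * hx - ((i : A) * y ^ (i - 1)) * hxw
      rw [this]
      rcases i with _ | i
      · simp
      · exact hcast _ (hmem i 1 1 (by simp) (by simp) _ (by push_cast; ring))
    · have : (y ^ i * x - (i : A) * (y ^ (i - 1) * w)) * x ^ 1 * w ^ 1 = 0 := by
        linear_combination (norm := noncomm_ring) y ^ i * hx * w -
          ((i : A) * y ^ (i - 1)) * hxw * w + ((i : A) * y ^ (i - 1)) * x * hw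
      rw [this]
      exact Submodule.zero_mem _

/-- Modulo `m` the degree of a normal word is `u + v ≤ 2 < m`, so only `y^p` has degree `p * m`. -/
theorem wordSpan_eq_bot {x y : A} {p : ℕ} (hy : y ^ p = 0) {m : ℤ} (hm : 3 ≤ m) :
    wordSpan K x y m (p * m) = ⊥ := by
  rw [eq_bot_iff]
  refine Submodule.span_le.2 ?_
  rintro _ ⟨i, u, v, hu, hv, h, rfl⟩
  have h1 : ((p : ℤ) - (i + v)) * m = u + v := by linarith
  have h2 : (u : ℤ) + v = 0 := by
    refine Int.eq_zero_of_abs_lt_dvd (m := m) ⟨(p : ℤ) - (i + v), by rw [← h1]; ring⟩ ?_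
    rw [abs_of_nonneg (by positivity)]
    omega
  obtain rfl : u = 0 := by omega
  obtain rfl : v = 0 := by omega
  have h3 : (p : ℤ) = i := by
    have : ((p : ℤ) - i) * m = 0 := by simpa using h1
    rcases mul_eq_zero.1 this with h | h <;> omega
  obtain rfl : p = i := by omega
  simp [hy]

variable {e : SteenrodGen p → A} [Fact p.Prime] [CharP K p]

/-- In degrees below that of `P^p` only `β` and `P^i` with `i < p` occur, and for `0 < i < p` the
latter is a multiple of `y^i` since `i! c^(i-1)` is invertible. -/
theorem AdemRelations.mul_mem_wordSpan (H : AdemRelations c e) (hp : p ≠ 2) (hc : c ≠ 0) {d : ℤ}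
    (hd : d < p * SteenrodGen.lowDegree p) {a : A} (ha : a ∈ steenrodGrading K e d) {k : ℤ} {b : A}
    (hb : b ∈ wordSpan K (e (.beta hp)) (e (.P 1)) (SteenrodGen.lowDegree p) k) :
    a * b ∈ wordSpan K (e (.beta hp)) (e (.P 1)) (SteenrodGen.lowDegree p) (d + k) := by
  have hp2 : 2 < p := lt_of_le_of_ne (Fact.out : p.Prime).two_le (Ne.symm hp)
  have h2 : (2 : K) ≠ 0 := by
    intro h
    have : p ∣ 2 := (CharP.cast_eq_zero_iff K p 2).1 (by exact_mod_cast h)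
    exact absurd (Nat.le_of_dvd (by norm_num) this) (by omega)
  have hm : SteenrodGen.lowDegree p = 2 * (p - 1) := by simp [SteenrodGen.lowDegree, hp]
  set m := SteenrodGen.lowDegree p
  let C : ℤ → Submodule K A := fun d => if d < 0 then ⊥ else if d < p * m then
    (wordSpan K (e (.beta hp)) (e (.P 1)) m (d + k)).comap (LinearMap.mulRight K b) else ⊤
  have hmain := steenrodGrading_induction (e := e) (C := C) ?_ ?_ d ha
  · simp only [C] at hmain
    split_ifs at hmain with h0
    · rw [(Submodule.mem_bot K).1 hmain, zero_mul]
      exact Submodule.zero_mem _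
    · exact hmain
  · simp only [C, lt_irrefl, if_false]
    split_ifs
    · simpa using hb
    · trivial
  · intro s l a ha
    have h0 := s.degree_nonneg
    simp only [C] at ha ⊢
    by_cases hl : l < 0
    · rw [if_pos hl, Submodule.mem_bot] at ha
      rw [ha, mul_zero]
      exact Submodule.zero_mem _
    · rw [if_neg (show ¬ s.degree + l < 0 by omega)]
      split_ifs with hlt
      · rw [if_neg hl, if_pos (by omega), Submodule.mem_comap, LinearMap.mulRight_apply] at ha
        rw [Submodule.mem_comap, LinearMap.mulRight_apply, mul_assoc]
        cases s with
        | beta h =>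
          rw [add_assoc]
          exact mul_x_mem_wordSpan h2 (H.beta_mul_self hp) (H.serre_relation hp) ha
        | P i =>
          have hdeg : (SteenrodGen.P i : SteenrodGen p).degree = i * m := by
            rw [hm, SteenrodGen.degree, if_neg hp]; ring
          rw [hdeg] at hlt ⊢
          have hi : i < p := by
            have : (i : ℤ) * m < p * m := by omega
            have := lt_of_mul_lt_mul_right this (by omega)
            omega
          rcases i with _ | i
          · rw [H.P_zero, ← Algebra.smul_def]
            simpa using Submodule.smul_mem _ _ ha
          · have hne : (((i + 1).factorial : K) * c ^ i) ≠ 0 := by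
              refine mul_ne_zero (fun h => ?_) (pow_ne_zero _ hc)
              rw [CharP.cast_eq_zero_iff K p, (Fact.out : p.Prime).dvd_factorial] at h
              omega
            have h := H.P_one_pow hp i
            rw [← inv_smul_eq_iff₀ hne] at h
            rw [← h, smul_mul_assoc, add_assoc]
            exact Submodule.smul_mem _ _ (mul_y_pow_mem_wordSpan ha (i + 1))
      · trivial

theorem AdemRelations.mul_eq_zero_of_degree (H : AdemRelations c e) (hp : p ≠ 2) (hc : c ≠ 0)
    {d d' : ℤ} (hd : 0 < d) (hd' : 0 < d') (h : d + d' = p * SteenrodGen.lowDegree p) {a b : A}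
    (ha : a ∈ steenrodGrading K e d) (hb : b ∈ steenrodGrading K e d') : a * b = 0 := by
  have hp2 : 2 < p := lt_of_le_of_ne (Fact.out : p.Prime).two_le (Ne.symm hp)
  have h1 : (1 : A) ∈
      wordSpan K (e (.beta hp)) (e (.P 1)) (SteenrodGen.lowDegree p) 0 :=
    Submodule.subset_span ⟨0, 0, 0, by simp, by simp, by simp, by simp⟩
  have hb' := H.mul_mem_wordSpan hp hc (by omega) hb h1
  have hab := H.mul_mem_wordSpan hp hc (by omega) ha hb'
  rw [mul_one, add_zero, h, wordSpan_eq_bot (H.P_one_pow_char hp) ?_] at hab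
  · exact (Submodule.mem_bot K).1 hab
  · simp only [SteenrodGen.lowDegree, if_neg hp]
    omega

end OddSpan
-- The contradiction from a twisted representation
section Contradiction

open LieSuperalgebra (signElt)

/-- The parity operator of the module `lowRep`, with entries in an algebra. -/
def signMatrix (A : Type*) [Ring A] : Matrix (Fin 3) (Fin 3) A := !![1, 0, 0; 0, -1, 0; 0, 0, -1]

variable {K : Type*} [Field K] {p : ℕ} {c : K} {A : Type*} [Ring A] [Algebra K A]
  {e : SteenrodGen p → A}

theorem signMatrix_mul_self (A : Type*) [Ring A] : signMatrix A * signMatrix A = 1 := by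
  ext a b
  fin_cases a <;> fin_cases b <;> simp [signMatrix, Matrix.mul_apply, Fin.sum_univ_three]

theorem commute_signMatrix_scalar {A : Type*} [Ring A] (a : A) :
    Commute (signMatrix A) (Matrix.scalar (Fin 3) a) := by
  refine (Matrix.scalar_commute_iff.2 ?_).symm
  ext i j
  fin_cases i <;> fin_cases j <;> simp [signMatrix]

theorem commute_map_scalar {K A : Type*} [Field K] [Ring A] [Algebra K A]
    (M : Matrix (Fin 3) (Fin 3) K) (a : A) :
    Commute (M.map (algebraMap K A)) (Matrix.scalar (Fin 3) a) := by
  refine (Matrix.scalar_commute_iff.2 ?_).symm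
  ext i j
  simp [Algebra.commutes]

/-- `T` is given on `G k` by the formula for primitive elements of degree `k`. -/
def IsTwist (ρ : A →ₐ[K] Matrix (Fin 3) (Fin 3) K) (T : A →ₐ[K] Matrix (Fin 3) (Fin 3) A)
    (G : ℤ → Set A) : Prop :=
  ∀ k, ∀ a ∈ G k, T a = (ρ a).map (algebraMap K A) +
    signElt (signMatrix A) (k : ZMod 2) * Matrix.scalar (Fin 3) a

variable {ρ : A →ₐ[K] Matrix (Fin 3) (Fin 3) K} {T : A →ₐ[K] Matrix (Fin 3) (Fin 3) A}
  {G : ℤ → Set A}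

theorem IsTwist.span (hT : IsTwist ρ T G) : IsTwist ρ T (fun k => Submodule.span K (G k)) := by
  intro k a ha
  induction ha using Submodule.span_induction with
  | mem a ha => exact hT k a ha
  | zero => simp
  | add a b _ _ ha hb =>
    rw [map_add, map_add, map_add, ha, hb, Matrix.map_add _ (by simp), mul_add]
    abel
  | smul r a _ ha =>
    have h1 : (r • ρ a).map (algebraMap K A) = r • (ρ a).map (algebraMap K A) := by
      ext i j
      exact (congrArg _ (smul_eq_mul r _)).trans
        ((map_mul _ _ _).trans (Algebra.smul_def r _).symm)
    have h2 : Matrix.scalar (Fin 3) (r • a) = r • Matrix.scalar (Fin 3) a :=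
      map_smul (Matrix.scalarAlgHom (Fin 3) K) r a
    rw [map_smul, map_smul, ha, h1, h2, mul_smul_comm, smul_add]

/-- A scalar satisfying the Leibniz formula obeys `r = r + r`. -/
theorem IsTwist.eq_zero_of_mem_zero (hT : IsTwist ρ T G) {r : K}
    (hr : algebraMap K A r ∈ G 0) : algebraMap K A r = 0 := by
  have h := congrFun (congrFun (hT 0 _ hr) 0) 0
  simpa [signElt, Matrix.algebraMap_matrix_apply] using h

theorem IsTwist.eq_zero_of_nonpos [Fact p.Prime] (hT : IsTwist ρ T G) (H : AdemRelations c e)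
    (hG : ∀ k, steenrodGrading K e k = generatedGrading K G k) {k : ℤ} (hk : k ≤ 0) {a : A}
    (ha : a ∈ G k) : a = 0 := by
  have ha' : a ∈ steenrodGrading K e k := by rw [hG]; exact mem_generatedGrading ha
  rcases hk.lt_or_eq with hk | rfl
  · exact eq_zero_of_mem_steenrodGrading_neg hk ha'
  · have := H.mem_span_pow (d := 0)
      (by have := SteenrodGen.two_le_lowDegree (p := p); push_cast; omega) ha'
    rw [pow_zero, Submodule.mem_span_singleton] at this
    obtain ⟨r, rfl⟩ := this
    rw [← Algebra.algebraMap_eq_smul_one] at ha ⊢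
    exact hT.eq_zero_of_mem_zero ha

theorem lower_triangular_pow (y : A) (n : ℕ) :
    !![y, 0, 0; 0, y, 0; 0, 1, y] ^ n = !![y ^ n, 0, 0; 0, y ^ n, 0; 0, n * y ^ (n - 1), y ^ n] := by
  induction n with
  | zero => simp [Matrix.one_fin_three]
  | succ n ih =>
    rw [pow_succ', ih]
    have : y * (n * y ^ (n - 1)) = n * y ^ n := by
      rcases n with _ | n
      · simp
      · rw [← mul_assoc, ← Nat.cast_comm, mul_assoc, ← pow_succ', Nat.add_sub_cancel]
    ext i j
    fin_cases i <;> fin_cases j <;>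
      simp [Matrix.mul_apply, Fin.sum_univ_three, pow_succ', this, add_mul, add_comm]

variable [Fact p.Prime] [CharP K p]

theorem IsTwist.false (H : AdemRelations c e) (hρP : ∀ i, ρ (e (.P i)) =
      SteenrodAlgebra.lowRepP K p c i)
    (hρB : ∀ h, ρ (e (.beta h)) = SteenrodAlgebra.lowRepBeta K)
    (hG : ∀ k, steenrodGrading K e k = generatedGrading K G k) (hT : IsTwist ρ T G) : False := by
  have hm := SteenrodGen.two_le_lowDegree (p := p)
  have hA : Nontrivial A := by
    by_contra h
    rw [not_nontrivial_iff_subsingleton] at h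
    have := congrArg ρ (Subsingleton.elim (1 : A) 0)
    simp at this
  -- In a degree without decomposable elements everything comes from `g`, so the Leibniz formula
  -- holds there.
  have hprim : ∀ n : ℤ, 0 < n → (∀ d d' : ℤ, 0 < d → 0 < d' → d + d' = n →
      ∀ a ∈ steenrodGrading K e d, ∀ b ∈ steenrodGrading K e d', a * b = 0) →
      ∀ a ∈ steenrodGrading K e n, T a = (ρ a).map (algebraMap K A) +
        signElt (signMatrix A) (n : ZMod 2) * Matrix.scalar (Fin 3) a := by
    intro n hn h a ha
    simp only [hG] at h ha
    exact hT.span n a (generatedGrading_le_span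
      (fun k hk a ha => hT.eq_zero_of_nonpos H hG hk ha) hn h ha)
  have hρx : ρ (e (.bottom p)) = SteenrodAlgebra.lowRepBeta K := by
    by_cases h : p = 2
    · subst h
      rw [SteenrodGen.bottom, dif_pos rfl, hρP]
      simp [SteenrodAlgebra.lowRepP, SteenrodAlgebra.lowIndex, SteenrodAlgebra.lowRepBeta]
    · rw [SteenrodGen.bottom, dif_neg h, hρB]
  have hρy : ρ (e (.P (SteenrodAlgebra.lowIndex p))) = !![0, 0, 0; 0, 0, 0; 0, 1, 0] := by
    have : SteenrodAlgebra.lowIndex p ≠ 0 := by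
      unfold SteenrodAlgebra.lowIndex; split_ifs <;> simp
    rw [hρP, SteenrodAlgebra.lowRepP, if_neg this, if_pos rfl]
  have hTx := hprim 1 one_pos (fun d d' _ _ _ => by omega) (e (.bottom p))
    (by simpa [SteenrodGen.degree_bottom] using gen_mem_steenrodGrading (K := K) (e := e) (.bottom p))
  have hTy := hprim (SteenrodGen.lowDegree p) (by omega)
    (fun d d' hd hd' h a ha b hb => H.mul_eq_zero_of_lowDegree hd hd' h ha hb)
    (e (.P (SteenrodAlgebra.lowIndex p)))
    (by rw [← SteenrodGen.degree_P_lowIndex]; exact gen_mem_steenrodGrading _)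
  have heven : signElt (signMatrix A) ((SteenrodGen.lowDegree p : ℤ) : ZMod 2) = 1 := by
    have : ((SteenrodGen.lowDegree p : ℤ) : ZMod 2) = 0 := by
      rw [ZMod.intCast_zmod_eq_zero_iff_dvd]
      unfold SteenrodGen.lowDegree
      split_ifs
      · simp
      · exact Dvd.intro _ rfl
    simp [signElt, this]
  rw [heven, hρy] at hTy
  rw [hρx] at hTx
  set x := e (.bottom p)
  set y := e (.P (SteenrodAlgebra.lowIndex p)) with hy
  have hTx' : T x = !![x, 0, 0; 1, -x, 0; 0, 0, -x] := by
    rw [hTx]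
    ext i j
    fin_cases i <;> fin_cases j <;>
      simp [SteenrodAlgebra.lowRepBeta, signElt, signMatrix]
  have hTy' : T y = !![y, 0, 0; 0, y, 0; 0, 1, y] := by
    rw [hTy]
    ext i j
    fin_cases i <;> fin_cases j <;> simp
  by_cases hp : p = 2
  · subst hp
    have hr : c • (y * y) = x * y * x := H.sq_two_relation
    -- In this entry `T(y)²` vanishes, while `T(x) T(y) T(x)` has `-x`.
    have h := congrFun (congrFun (congrArg T hr) 2) 0
    rw [map_smul, map_mul, map_mul, map_mul, hTx', hTy'] at h
    have hx : x = 0 := by simpa [Matrix.mul_apply, Fin.sum_univ_three] using h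
    have := congrFun (congrFun hρx 1) 0
    rw [hx, map_zero] at this
    simp [SteenrodAlgebra.lowRepBeta] at this
  · have hp2 : 2 < p := lt_of_le_of_ne (Fact.out : p.Prime).two_le (Ne.symm hp)
    have hlow : SteenrodAlgebra.lowIndex p = 1 := if_neg hp
    have hx : x = e (.beta hp) := by simp [x, SteenrodGen.bottom, hp]
    rw [hlow] at hy
    have hcancel : ∀ n : ℕ, 0 < n → n < p → ∀ a : A, (n : A) * a = 0 → a = 0 := by
      intro n hn hnp a h
      have hne : (n : K) ≠ 0 := fun h => absurd
        (Nat.le_of_dvd hn ((CharP.cast_eq_zero_iff K p n).1 h)) (by omega)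
      rw [← map_natCast (algebraMap K A), ← Algebra.smul_def] at h
      exact (smul_eq_zero.1 h).resolve_left hne
    -- The `(2, 1)` entry of `T(y)^n` is `n * y ^ (n - 1)`, and `n` is invertible in `K`; descent
    -- from `y^n = 0` ends at `1 = 0`.
    have hstep : ∀ n : ℕ, 0 < n → n < p → y ^ n = 0 → y ^ (n - 1) = 0 := by
      intro n hn hnp h
      have h' := congrFun (congrFun (congrArg T h) 2) 1
      rw [map_pow, hTy', lower_triangular_pow, map_zero] at h'
      exact hcancel n hn hnp _ (by simpa using h')
    have hpow : ∀ n : ℕ, n < p → y ^ n ≠ 0 := by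
      intro n
      induction n with
      | zero => simp
      | succ n ih => exact fun hn h => ih (by omega) (hstep (n + 1) (by omega) hn h)
    by_cases hc : c = 0
    · refine hpow 2 hp2 ?_
      rw [pow_two, hy, H.P_one_mul hp one_pos, hc, mul_zero, zero_smul]
    · have hdeg : (SteenrodGen.P p : SteenrodGen p).degree = p * SteenrodGen.lowDegree p := by
        simp only [SteenrodGen.degree, SteenrodGen.lowDegree, if_neg hp]
        ring
      have hTz := hprim (p * SteenrodGen.lowDegree p) (by positivity)
        (fun d d' hd hd' h a ha b hb => H.mul_eq_zero_of_degree hp hc hd hd' h ha hb) (e (.P p))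
        (by rw [← hdeg]; exact gen_mem_steenrodGrading _)
      have hρz : ρ (e (.P p)) = 0 := by
        rw [hρP, SteenrodAlgebra.lowRepP_of_ne_two hp c hp2.le]
      have hs : signElt (signMatrix A) ((p * SteenrodGen.lowDegree p : ℤ) : ZMod 2) = 1 := by
        have : ((p * SteenrodGen.lowDegree p : ℤ) : ZMod 2) = 0 := by
          rw [ZMod.intCast_zmod_eq_zero_iff_dvd]
          refine Dvd.dvd.mul_left ?_ _
          rw [SteenrodGen.lowDegree, if_neg hp]
          exact Dvd.intro _ rfl
        simp [signElt, this]
      rw [hρz, hs] at hTz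
      have hr := H.beta_P_relation hp
      simp only at hr
      rw [← hx, ← hy] at hr
      -- As `T(z)` is the scalar matrix `z` and `T(x)` has zero `(2, 0)` entry, the right side
      -- contributes `0`; the left side contributes `y^(p-1)`.
      have h := congrFun (congrFun (congrArg T hr) 2) 0
      rw [map_smul, map_sub, map_mul, map_mul, map_mul, map_mul, map_pow, hTx', hTy', hTz,
        lower_triangular_pow] at h
      refine hpow (p - 1) (by omega) ?_
      simpa [Matrix.mul_apply, Fin.sum_univ_three] using h

end Contradiction

/-! ### Transport to the two enveloping algebras -/

section Enveloping

variable {K : Type*} [Field K] {p : ℕ} [Fact p.Prime] [CharP K p] {c : K}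
  {g : Type*} [AddCommGroup g] [Module K g]

omit [Fact p.Prime] [CharP K p] in
theorem supercommute_signMatrix {A B : Type*} [Ring A] [Algebra K A] [Ring B] [Algebra K B]
    {e : SteenrodGen p → A} {ρ : A →ₐ[K] Matrix (Fin 3) (Fin 3) K}
    (hρP : ∀ i, ρ (e (.P i)) = SteenrodAlgebra.lowRepP K p c i)
    (hρB : ∀ h, ρ (e (.beta h)) = SteenrodAlgebra.lowRepBeta K) {k : ℤ} {a : A}
    (ha : a ∈ steenrodGrading K e k) :
    signMatrix B * (ρ a).map (algebraMap K B) =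
      (k.negOnePow : ℤ) • ((ρ a).map (algebraMap K B) * signMatrix B) := by
  -- Only generators need checking: `signMatrix` is the parity operator of a basis in degrees `0`,
  -- `1`, `1 + lowDegree p`, the last being odd.
  refine supercommute_of_mem_steenrodGrading (R := Matrix (Fin 3) (Fin 3) B)
    ((Algebra.ofId K B).mapMatrix.comp ρ) (signMatrix B) (fun t => ?_) ha
  change signMatrix B * (ρ (e t)).map (algebraMap K B) =
      (t.degree.negOnePow : ℤ) • ((ρ (e t)).map (algebraMap K B) * signMatrix B)
  cases t with
  | beta h =>
    rw [hρB]
    ext i j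
    fin_cases i <;> fin_cases j <;> simp [SteenrodGen.degree, signMatrix,
      SteenrodAlgebra.lowRepBeta, Matrix.mul_apply, Fin.sum_univ_three]
  | P n =>
    rw [hρP]
    unfold SteenrodAlgebra.lowRepP SteenrodAlgebra.lowIndex SteenrodGen.degree
    dsimp only
    by_cases h0 : n = 0
    · subst h0
      ext i j
      fin_cases i <;> fin_cases j <;>
        simp [signMatrix, Matrix.mul_apply, Fin.sum_univ_three]
    rw [if_neg h0]
    by_cases hp : p = 2
    · simp only [if_pos hp]
      by_cases h2 : n = 2
      · subst h2
        rw [if_pos rfl, Int.negOnePow_even _ (by decide)]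
        ext i j
        fin_cases i <;> fin_cases j <;>
          simp [signMatrix, Matrix.mul_apply, Fin.sum_univ_three]
      rw [if_neg h2]
      by_cases h1 : n = 1
      · subst h1
        rw [if_pos rfl]
        ext i j
        fin_cases i <;> fin_cases j <;>
          simp [signMatrix, Matrix.mul_apply, Fin.sum_univ_three]
      · simp [h1]
    · simp only [if_neg hp]
      rw [Int.negOnePow_even _ ⟨n * (p - 1), by ring⟩]
      by_cases h1 : n = 1
      · rw [if_pos h1]
        ext i j
        fin_cases i <;> fin_cases j <;>
          simp [signMatrix, Matrix.mul_apply, Fin.sum_univ_three]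
      · simp [h1]

omit [Fact p.Prime] [CharP K p] in
theorem LieSuperalgebra.supercommute_of_mem_part (L : LieSuperalgebra K g)
    {𝒢 : ℤ → Submodule K g} (h𝒢 : L.IsZGrading 𝒢) {B : Type*} [Ring B] [Algebra K B]
    (r : g →ₗ[K] B) (s : B)
    (h : ∀ k, ∀ x ∈ 𝒢 k, s * r x = (k.negOnePow : ℤ) • (r x * s)) {i : ZMod 2} {x : g}
    (hx : x ∈ L.part i) : s * r x = superSign 1 i • (r x * s) := by
  let C : Submodule K g := LinearMap.ker ((LinearMap.mulLeft K s -
    superSign 1 i • LinearMap.mulRight K s) ∘ₗ r)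
  have hC : ∀ x, x ∈ C ↔ s * r x = superSign 1 i • (r x * s) := fun x => by
    simp only [C, LinearMap.mem_ker, LinearMap.comp_apply, LinearMap.sub_apply,
      LinearMap.smul_apply, LinearMap.mulLeft_apply, LinearMap.mulRight_apply, sub_eq_zero]
  refine (hC x).1 ((L.part_le_iSup h𝒢 i).trans (iSup₂_le fun k hk x hx => ?_) hx)
  rw [hC, h k x hx, ← hk]
  congr 1
  rcases Int.even_or_odd k with h | h
  · have : (k : ZMod 2) = 0 := (ZMod.intCast_zmod_eq_zero_iff_dvd k 2).2 h.two_dvd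
    simp [superSign, this, Int.negOnePow_even _ h]
  · have : (k : ZMod 2) = 1 := by
      obtain ⟨r, rfl⟩ := h
      have : (2 : ZMod 2) = 0 := rfl
      push_cast
      rw [this, zero_mul, zero_add]
    simp [superSign, this, Int.negOnePow_odd _ h]

open LieSuperalgebra in
/-- A graded isomorphism between the Steenrod algebra and an algebra with a representation of `g` that
satisfies the universal property for the twisted representation leads to a contradiction. -/
theorem not_isGradedIso_of_lift {L : LieSuperalgebra K g} {𝒢 : ℤ → Submodule K g}
    (h𝒢 : L.IsZGrading 𝒢) {U : Type*} [Ring U] [Algebra K U] {ι : g →ₗ[K] U} (hι : L.IsRep ι)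
    (hlift : ∀ (ρ j : U →ₐ[K] Matrix (Fin 3) (Fin 3) (SteenrodAlgebra K p c))
      (s : Matrix (Fin 3) (Fin 3) (SteenrodAlgebra K p c))
      (τ : g →ₗ[K] Matrix (Fin 3) (Fin 3) (SteenrodAlgebra K p c)),
      (∀ x y, Commute (ρ x) (j y)) → L.IsRep τ →
      (∀ i, ∀ x ∈ L.part i, τ x = ρ (ι x) + signElt s i * j (ι x)) →
      ∃ T : U →ₐ[K] Matrix (Fin 3) (Fin 3) (SteenrodAlgebra K p c), ∀ x, T (ι x) = τ x)
    (f : SteenrodAlgebra K p c ≃ₐ[K] U) :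
    ¬ IsGradedIso (SteenrodAlgebra.grading K p c)
      (generatedGrading K (fun k => ι '' (𝒢 k : Set g))) f := by
  intro hf
  obtain ⟨ρ, hρP, hρB⟩ := SteenrodAlgebra.exists_lowRep p c
  set A := SteenrodAlgebra K p c
  set e := SteenrodAlgebra.gen K p c
  -- The image of `g` pulled back to the Steenrod algebra; gradedness of `f` says exactly that it
  -- generates the same grading.
  let G : ℤ → Set A := fun k => f.symm '' (ι '' (𝒢 k : Set g))
  have hG : ∀ k, steenrodGrading K e k = generatedGrading K G k := by
    intro k
    have h := generatedGrading_map f.symm.toAlgHom (fun k => ι '' (𝒢 k : Set g)) k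
    rw [← hf k, ← Submodule.map_comp] at h
    refine Eq.trans ?_ h
    have hid : f.symm.toAlgHom.toLinearMap ∘ₗ f.toLinearMap = LinearMap.id := by
      ext a; simp
    rw [hid, Submodule.map_id]
    rfl
  let ρ' : U →ₐ[K] Matrix (Fin 3) (Fin 3) A :=
    ((Algebra.ofId K A).mapMatrix.comp ρ).comp f.symm.toAlgHom
  let j : U →ₐ[K] Matrix (Fin 3) (Fin 3) A :=
    (Matrix.scalarAlgHom (Fin 3) K).comp f.symm.toAlgHom
  have hρ' : ∀ u, ρ' u = (ρ (f.symm u)).map (algebraMap K A) := fun _ => rfl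
  have hj : ∀ u, j u = Matrix.scalar (Fin 3) (f.symm u) := fun _ => rfl
  have hcomm : ∀ x y, Commute (ρ' x) (j y) := fun x y => commute_map_scalar _ _
  have hsρ : ∀ i, ∀ x ∈ L.part i, signMatrix A * ρ' (ι x) =
      superSign 1 i • (ρ' (ι x) * signMatrix A) :=
    fun i x hx => L.supercommute_of_mem_part h𝒢 (ρ'.toLinearMap ∘ₗ ι) (signMatrix A)
      (fun k x hx => supercommute_signMatrix hρP hρB
        (by rw [hG]; exact mem_generatedGrading ⟨_, ⟨x, hx, rfl⟩, rfl⟩)) hx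
  obtain ⟨τ, hτ, hτι⟩ := L.exists_twist (hι.comp ρ') (hι.comp j) (fun x y => hcomm _ _)
    (signMatrix A) (signMatrix_mul_self A) (fun x => commute_signMatrix_scalar _)
    (fun x hx => by simpa [superSign] using hsρ 0 x hx)
    (fun x hx => by simpa [superSign] using hsρ 1 x hx)
  obtain ⟨T, hT⟩ := hlift ρ' j (signMatrix A) τ hcomm hτ hτι
  have htwist : IsTwist ρ (T.comp f.toAlgHom) G := by
    rintro k _ ⟨_, ⟨x, hx, rfl⟩, rfl⟩
    have h1 := hτι _ _ (h𝒢.parity k hx)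
    rw [← hT] at h1
    simpa [hρ', hj] using h1
  exact htwist.false (SteenrodAlgebra.ademRelations K p c) hρP hρB hG

end Enveloping

theorem mainTheorem1 {K : Type*} [Field K] (p : ℕ) [Fact p.Prime] [CharP K p] (c : K)
    {g : Type*} [AddCommGroup g] [Module K g] (L : LieSuperalgebra K g)
    (𝒢 : ℤ → Submodule K g) (h𝒢 : L.IsZGrading 𝒢) :
    (¬ ∃ f : SteenrodAlgebra K p c ≃ₐ[K] L.Enveloping,
      IsGradedIso (SteenrodAlgebra.grading K p c)
        (LieSuperalgebra.Enveloping.grading L 𝒢) f) ∧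
    (∀ R : L.RestrictedStructure p, R.IsHomogeneous 𝒢 →
      ¬ ∃ f : SteenrodAlgebra K p c ≃ₐ[K] LieSuperalgebra.RestrictedEnveloping R,
        IsGradedIso (SteenrodAlgebra.grading K p c)
          (LieSuperalgebra.RestrictedEnveloping.grading R 𝒢) f) := by
  refine ⟨fun ⟨f, hf⟩ => ?_, fun R _ ⟨f, hf⟩ => ?_⟩
  · exact not_isGradedIso_of_lift h𝒢 L.isRep_ι
      (fun ρ j s τ _ hτ _ => hτ.exists_lift) f hf
  · refine not_isGradedIso_of_lift h𝒢 (LieSuperalgebra.isRep_restricted_ι R)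
      (fun ρ j s τ hcomm hτ hτι => hτ.exists_lift_restricted R fun x => ?_) f hf
    -- On even elements the twist is trivial, and the `p`-th power is additive on the commuting
    -- summands, so it respects `x^p = x^[p]`.
    rw [hτι 0 _ x.2, hτι 0 _ (R.pmap x).2, LieSuperalgebra.signElt, if_neg zero_ne_one, one_mul,
      one_mul, add_pow_prime_of_commute K p (hcomm _ _), ← map_pow ρ,
      ← map_pow j, LieSuperalgebra.restricted_ι_pow]
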